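/- Let $c,d,t,c_1$ be natural numbers with $t\ge 1$, $d\ge 2t+1$ and $$c_1\ge 2,\qquad (c-c_1+1)\cdot\frac{t}{t+1}>1. \qquad (*)$$ **Ensemble.** For $N$ with $d\mid Nc$ put $J=Nc/d$. Each of $N$ variable nodes has $c$ sockets, each of $J$ check nodes has $d$ ordered sockets, and the variable sockets are matched with the check sockets by a uniformly random bijection (parallel edges are allowed). For a binary linear component code $\mathcal C_0$ of length $d$ in which distinct words have distance at least $2t+1$, the code of a matching is the set of $x\in\{0,1\}^N$ such that every check node reads a word of $\mathcal C_0$ at its sockets. **Decoder.** In each iteration every check node looks for a word $w\in\mathcal C_0$ at Hamming distance at most $t$ from the word it reads (it is unique if it exists); if there is one, the check node sends a flip message along each of its edges at which $w$ differs from the word read. Then all variable nodes that received at least $c_1$ flip messages (counted with edge multiplicity) are flipped simultaneously. A word $v$ is decoded to $x$ if the iteration started at $v$ equals $x$ from some iteration on. **Exponent.** Let $h(\tau_1,\dots,\tau_i)=-\sum_j\tau_j\log\tau_j-(1-\sum_j\tau_j)\log(1-\sum_j\tau_j)$ with $0\log 0=0$, and $$F_0=\sum_{j=c-c_1+1}^{c}\binom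 cj x^j,\quad F_1=\sum_{j=0}^{c-c_1}\binom cj x^j,\quad F_2=\sum_{j=c_1}^{c}\binom cj x^j,\quad F_3=\sum_{j=0}^{c_1-1}\binom cj x^j,$$ $$G_0=\sum_{j=t+1}^{d}\binom dj x^j,\quad G_1=\sum_{j=0}^{t}\binom dj x^j .$$ Let $\rho=t_1+t_2+u_1+u_2$, where (infima in $[-\infty,\infty)$) $$t_1=\inf_{x>0}\{\gamma\log F_0(x)+(\alpha-\gamma)\log F_1(x)-\omega c\log x\},$$ $$t_2=\inf_{x>0}\{\delta\log F_2(x)+(1-\alpha-\delta)\log F_3(x)-(\phi-\omega)c\log x\},$$ $$u_1=\inf_{x>0}\{\tfrac{\phi c}{d}\log G_0(x)-\omega c\log x\},\qquad u_2=\inf_{x>0}\{\tfrac{(1-\phi)c}{d}\log G_1(x)-(\alpha-\omega)c\log x\},$$ and let $f(\alpha)$ be the maximum, over $(\gamma,\delta,\phi,\omega)$, of $$\psi=h(\gamma,\alpha-\gamma,\delta)+\tfrac cd h(\phi)+\rho-c\,h(\omega,\alpha-\omega,\phi-\omega)$$ subject to $\delta\ge\alpha-\gamma$, $0\le\gamma\le\alpha$,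 $0\le\delta\le 1-\alpha$, $0\le\omega\le\min(\alpha,\phi)$, $\alpha-\omega\le 1-\phi$, $\phi\le\frac{\omega d}{t+1}$, $\delta\le\frac{(\phi-\omega)c}{c_1}$, $\gamma\le\frac{\omega c}{c-c_1+1}$. **Theorem.** The function $f$ has a smallest positive root $\alpha_0$. For every such $\mathcal C_0$ and every $\overline\alpha_0<\alpha_0$, the fraction of the socket matchings for which every codeword corrupted by any error pattern of weight at most $\lfloor\overline\alpha_0N\rfloor$ is decoded correctly tends to $1$ as $N\to\infty$ (through the $N$ with $d\mid Nc$). Moreover, condition $(*)$ holds with $c_1=\lceil c/2\rceil$ whenever $c\ge4$ and $t\ge1$, or $c=3$ and $t\ge2$. -/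

import Mathlib

open Filter Topology

namespace GLDPC

noncomputable section

/-! ### The exponent function -/

/-- The entropy function `h(τ₁, …, τᵢ)` (natural logarithm, `0 log 0 = 0`). -/
def entropy {i : ℕ} (τ : Fin i → ℝ) : ℝ :=
  (∑ j, Real.negMulLog (τ j)) + Real.negMulLog (1 - ∑ j, τ j)

/-- `F₀(x) = ∑_{j=c-c₁+1}^{c} (c choose j) x^j` (used with `c₁ ≤ c`). -/
def F0 (c c₁ : ℕ) (x : ℝ) : ℝ := ∑ j ∈ Finset.Icc (c - c₁ + 1) c, (c.choose j : ℝ) * x ^ j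

/-- `F₁(x) = ∑_{j=0}^{c-c₁} (c choose j) x^j` (used with `c₁ ≤ c`). -/
def F1 (c c₁ : ℕ) (x : ℝ) : ℝ := ∑ j ∈ Finset.Icc 0 (c - c₁), (c.choose j : ℝ) * x ^ j

/-- `F₂(x) = ∑_{j=c₁}^{c} (c choose j) x^j`. -/
def F2 (c c₁ : ℕ) (x : ℝ) : ℝ := ∑ j ∈ Finset.Icc c₁ c, (c.choose j : ℝ) * x ^ j

/-- `F₃(x) = ∑_{j=0}^{c₁-1} (c choose j) x^j` (used with `1 ≤ c₁`). -/
def F3 (c c₁ : ℕ) (x : ℝ) : ℝ := ∑ j ∈ Finset.Icc 0 (c₁ - 1), (c.choose j : ℝ) * x ^ j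

/-- `G₀(x) = ∑_{j=t+1}^{d} (d choose j) x^j`. -/
def G0 (d t : ℕ) (x : ℝ) : ℝ := ∑ j ∈ Finset.Icc (t + 1) d, (d.choose j : ℝ) * x ^ j

/-- `G₁(x) = ∑_{j=0}^{t} (d choose j) x^j`. -/
def G1 (d t : ℕ) (x : ℝ) : ℝ := ∑ j ∈ Finset.Icc 0 t, (d.choose j : ℝ) * x ^ j

/-- The infimum of a real function over `x > 0`, taken in the extended reals: it is `⊥ = -∞` when
the function is unbounded below. -/
def infPos (g : ℝ → ℝ) : EReal := ⨅ x : Set.Ioi (0 : ℝ), ((g x : ℝ) : EReal)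

def t1 (c c₁ : ℕ) (α γ ω : ℝ) : EReal :=
  infPos fun x => γ * Real.log (F0 c c₁ x) + (α - γ) * Real.log (F1 c c₁ x)
    - ω * c * Real.log x

def t2 (c c₁ : ℕ) (α δ φ ω : ℝ) : EReal :=
  infPos fun x => δ * Real.log (F2 c c₁ x) + (1 - α - δ) * Real.log (F3 c c₁ x)
    - (φ - ω) * c * Real.log x

def u1 (c d t : ℕ) (φ ω : ℝ) : EReal :=
  infPos fun x => φ * c / d * Real.log (G0 d t x) - ω * c * Real.log x

def u2 (c d t : ℕ) (α φ ω : ℝ) : EReal :=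
  infPos fun x => (1 - φ) * c / d * Real.log (G1 d t x) - (α - ω) * c * Real.log x

/-- `ρ = t₁ + t₂ + u₁ + u₂`. No summand is `+∞`. -/
def rho (c d t c₁ : ℕ) (α γ δ φ ω : ℝ) : EReal :=
  t1 c c₁ α γ ω + t2 c c₁ α δ φ ω + u1 c d t φ ω + u2 c d t α φ ω

/-- `ψ = h(γ, α-γ, δ) + (c/d) h(φ) + ρ - c h(ω, α-ω, φ-ω)`. -/
def psi (c d t c₁ : ℕ) (α γ δ φ ω : ℝ) : EReal :=
  ((entropy ![γ, α - γ, δ] + (c : ℝ) / d * entropy ![φ]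
      - c * entropy ![ω, α - ω, φ - ω] : ℝ) : EReal)
    + rho c d t c₁ α γ δ φ ω

/-- The polyhedron of parameters `(γ, δ, φ, ω)` admissible for `α`. -/
structure Feasible (c d t c₁ : ℕ) (α γ δ φ ω : ℝ) : Prop where
  bad : α - γ ≤ δ
  gamma_nonneg : 0 ≤ γ
  gamma_le : γ ≤ α
  delta_nonneg : 0 ≤ δ
  delta_le : δ ≤ 1 - α
  omega_nonneg : 0 ≤ ω * c
  omega_le : ω * c ≤ min α φ * c
  edges_le : (α - ω) * c ≤ (1 - φ) * c
  phi_le : φ ≤ ω * d / (t + 1)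
  delta_le' : δ ≤ (φ - ω) * c / c₁
  gamma_le' : γ ≤ ω * c / ((c : ℝ) - c₁ + 1)

/-- `f(α)`, the maximum of `ψ(α, γ, δ, φ, ω)` over all admissible `(γ, δ, φ, ω)`, as a supremum in
the extended reals. -/
def f (c d t c₁ : ℕ) (α : ℝ) : EReal :=
  sSup {y | ∃ γ δ φ ω : ℝ, Feasible c d t c₁ α γ δ φ ω ∧ y = psi c d t c₁ α γ δ φ ω}

/-- The condition on the flip threshold: `c₁ ≥ 2` and `(c - c₁ + 1) · t / (t + 1) > 1`. -/
def ThresholdCondition (c t c₁ : ℕ) : Prop :=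
  2 ≤ c₁ ∧ ((c : ℝ) - c₁ + 1) * ((t : ℝ) / (t + 1)) > 1

/-! ### The code ensemble -/

/-- The distance between distinct words of `C₀` is at least `m`. -/
def MinDistAtLeast {d : ℕ} (C₀ : Submodule (ZMod 2) (Fin d → ZMod 2)) (m : ℕ) : Prop :=
  ∀ x ∈ C₀, ∀ y ∈ C₀, x ≠ y → m ≤ hammingDist x y

/-- The `(c, d)`-regular ensemble with `N` variable nodes and `J` check nodes: all matchings of the
`N * c` variable sockets with the `J * d` check sockets. Parallel edges are allowed. -/
abbrev Ensemble (N J c d : ℕ) : Type := (Fin N × Fin c) ≃ (Fin J × Fin d)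

variable {N J c d : ℕ}

/-- The vector `v_j` of values read by the check node `j` at its `d` sockets. -/
def checkWord (E : Ensemble N J c d) (v : Fin N → ZMod 2) (j : Fin J) : Fin d → ZMod 2 :=
  fun m => v (E.symm (j, m)).1

/-- The GLDPC code of the Tanner graph `E` with component code `C₀`. -/
def code (E : Ensemble N J c d) (C₀ : Submodule (ZMod 2) (Fin d → ZMod 2)) :
    Set (Fin N → ZMod 2) :=
  {v | ∀ j, checkWord E v j ∈ C₀}

/-! ### The decoder -/

open Classical in
/-- `t`-bounded distance decoding: a codeword at distance at most `t` if there is one (it is unique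
when the minimum distance is at least `2t+1`), and `none` otherwise. -/
def bdd (C₀ : Submodule (ZMod 2) (Fin d → ZMod 2)) (t : ℕ) (v : Fin d → ZMod 2) :
    Option (Fin d → ZMod 2) :=
  if h : ∃ w ∈ C₀, hammingDist v w ≤ t then some h.choose else none

/-- The check node `j` sends a flip message through its socket `m`. -/
def SendsFlip (E : Ensemble N J c d) (C₀ : Submodule (ZMod 2) (Fin d → ZMod 2)) (t : ℕ)
    (v : Fin N → ZMod 2) (j : Fin J) (m : Fin d) : Prop :=
  ∃ w, bdd C₀ t (checkWord E v j) = some w ∧ w m ≠ checkWord E v j m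

open Classical in
/-- The number of flip messages received by the variable node `i`, one vote per edge. -/
def flipCount (E : Ensemble N J c d) (C₀ : Submodule (ZMod 2) (Fin d → ZMod 2)) (t : ℕ)
    (v : Fin N → ZMod 2) (i : Fin N) : ℕ :=
  (Finset.univ.filter fun k : Fin c => SendsFlip E C₀ t v (E (i, k)).1 (E (i, k)).2).card

/-- One iteration of parallel bit flipping: every variable node with at least `c₁` flip messages
is flipped. -/
def step (E : Ensemble N J c d) (C₀ : Submodule (ZMod 2) (Fin d → ZMod 2)) (t c₁ : ℕ)
    (v : Fin N → ZMod 2) : Fin N → ZMod 2 :=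
  fun i => if c₁ ≤ flipCount E C₀ t v i then v i + 1 else v i

/-- The decoder started at `v` ends at `x`: the values equal `x` from some iteration on. -/
def DecodesTo (E : Ensemble N J c d) (C₀ : Submodule (ZMod 2) (Fin d → ZMod 2)) (t c₁ : ℕ)
    (v x : Fin N → ZMod 2) : Prop :=
  ∃ L : ℕ, ∀ l ≥ L, (step E C₀ t c₁)^[l] v = x

/-- Every codeword corrupted in at most `W` positions is decoded correctly. -/
def CorrectsAll (E : Ensemble N J c d) (C₀ : Submodule (ZMod 2) (Fin d → ZMod 2)) (t c₁ W : ℕ) :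
    Prop :=
  ∀ x ∈ code E C₀, ∀ v : Fin N → ZMod 2, hammingDist v x ≤ W → DecodesTo E C₀ t c₁ v x

/-- The fraction of the socket matchings with `N` variable nodes and `N * c / d` check nodes whose
code corrects all error patterns of weight at most `W`. It is meaningful when `d ∣ N * c`. -/
def goodFraction (N c : ℕ) {d : ℕ} (C₀ : Submodule (ZMod 2) (Fin d → ZMod 2)) (t c₁ W : ℕ) : ℝ :=
  (Nat.card {E : Ensemble N (N * c / d) c d // CorrectsAll E C₀ t c₁ W} : ℝ) /
    Nat.card (Ensemble N (N * c / d) c d)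

end

end GLDPC

namespace GLDPC

noncomputable section

/-! ### The exponent as a lower envelope -/

/-! Let `A` be the set of erroneous nodes. A check that reads at most `t` errors decodes to the
correct word, so its messages point exactly at the errors. Hence after one iteration an error can
survive only at a node of `A` with at least `c - c₁ + 1` edges to overloaded checks, and a new error
can appear only at a node outside `A` with at least `c₁` such edges (`ne_step_subset`). If these two
kinds of nodes are fewer than `#A` for every `A` of size between `1` and `W`, the number of errors
drops strictly until it is `0`; codewords are fixed points. So it suffices to bound, for each size
`a`, the matchings in `failSet`.

Fix the numbers of surviving and new errors, of overloaded checks, and of edges between errors and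
overloaded checks. A matching with an error set is described by what the variable nodes see, what
the check nodes see, and a bijection of sockets respecting the four resulting colours. The two views
are counted by an exponential tilting bound (`card_mul_prod_pow_le`), the bijections by four
factorials. With Stirling's formula the fraction of matchings is at most a polynomial in `a` times
`exp (N * psiAt)` (`card_profileSet_le`). The polynomial does not involve `N`: the only large colour
class, correct nodes against good checks, contributes a square root that cancels against the one in
`(N * c)!`.

The exponent is controlled in two regimes. As `α → 0` it is `-log α` times a linear form in the
parameters, up to `O(α)`, and the threshold condition makes that form at most `-κ α` with `κ > 0`
(`bracket_le`); thus `f` lies below every line through the origin near `0`. Away from `0`, `psi` is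
upper semicontinuous on a compact feasible set. Since `psi ≥ 0` at a feasible point for `α = 1`,
there is a least `α₀` with a feasible point where `psi ≥ 0`. Scaling the parameters down shows that
`f α₀ > 0` would give such a point at a smaller `α`, so `f α₀ = 0` (`exists_isLeast_root`).

Below `α₀` this gives `f α ≤ -η α`, so the fraction for size `a` is dominated by a polynomial times
`exp (-η a)`, which is summable. For fixed `a`, `a / N → 0` and the infinite slope sends the
fraction to `0`. Dominated convergence then finishes the proof (`tendsto_goodFraction`). -/

/-- The entropy part of the exponent `psi`. -/
def entropyPart (c d : ℕ) (α γ δ φ ω : ℝ) : ℝ :=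
  entropy ![γ, α - γ, δ] + (c : ℝ) / d * entropy ![φ] - c * entropy ![ω, α - ω, φ - ω]

/-- The expression whose infimum over `x₁, x₂, x₃, x₄ > 0` is `rho`. -/
def rhoAt (c d t c₁ : ℕ) (α γ δ φ ω x₁ x₂ x₃ x₄ : ℝ) : ℝ :=
  (γ * Real.log (F0 c c₁ x₁) + (α - γ) * Real.log (F1 c c₁ x₁) - ω * c * Real.log x₁)
  + (δ * Real.log (F2 c c₁ x₂) + (1 - α - δ) * Real.log (F3 c c₁ x₂)
      - (φ - ω) * c * Real.log x₂)
  + (φ * c / d * Real.log (G0 d t x₃) - ω * c * Real.log x₃)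
  + ((1 - φ) * c / d * Real.log (G1 d t x₄) - (α - ω) * c * Real.log x₄)

/-- The expression whose infimum over `x₁, x₂, x₃, x₄ > 0` is `psi`. -/
def psiAt (c d t c₁ : ℕ) (α γ δ φ ω x₁ x₂ x₃ x₄ : ℝ) : ℝ :=
  entropyPart c d α γ δ φ ω + rhoAt c d t c₁ α γ δ φ ω x₁ x₂ x₃ x₄

lemma infPos_le (g : ℝ → ℝ) {x : ℝ} (hx : 0 < x) : infPos g ≤ (g x : EReal) :=
  iInf_le (fun x : Set.Ioi (0 : ℝ) => ((g x : ℝ) : EReal)) ⟨x, hx⟩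

lemma infPos_ne_top (g : ℝ → ℝ) : infPos g ≠ ⊤ :=
  ne_top_of_le_ne_top (EReal.coe_ne_top _) (infPos_le g one_pos)

/-- Peels one infimum off a sum in the extended reals. If `A = ⊥`, a single point already forces `r
= ⊥`; if `A` is real, it can be moved to the other side. -/
lemma le_infPos_add {g : ℝ → ℝ} {A r : EReal} (hA : A ≠ ⊤)
    (h : ∀ x, 0 < x → r ≤ (g x : EReal) + A) : r ≤ infPos g + A := by
  induction A with
  | bot => simpa using h 1 one_pos
  | top => exact absurd rfl hA
  | coe a =>
    rw [← EReal.sub_le_iff_le_add (.inl (EReal.coe_ne_bot _)) (.inl (EReal.coe_ne_top _))]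
    exact le_iInf fun x => EReal.sub_le_of_le_add (h x.1 x.2)

/-- A sum of infima in separate variables is the joint infimum, since no summand is `⊤`. This lets
the value `-∞` be avoided by working with the real-valued `psiAt`. -/
lemma le_psi_iff {c d t c₁ : ℕ} {α γ δ φ ω : ℝ} {r : EReal} :
    r ≤ psi c d t c₁ α γ δ φ ω ↔ ∀ x₁ > 0, ∀ x₂ > 0, ∀ x₃ > 0, ∀ x₄ > 0,
      r ≤ (psiAt c d t c₁ α γ δ φ ω x₁ x₂ x₃ x₄ : ℝ) := by
  constructor
  · intro h x₁ h₁ x₂ h₂ x₃ h₃ x₄ h₄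
    refine h.trans ?_
    unfold psi rho psiAt rhoAt entropyPart
    rw [EReal.coe_add, EReal.coe_add, EReal.coe_add, EReal.coe_add]
    refine add_le_add le_rfl (add_le_add (add_le_add (add_le_add ?_ ?_) ?_) ?_)
    · exact infPos_le _ h₁
    · exact infPos_le _ h₂
    · exact infPos_le _ h₃
    · exact infPos_le _ h₄
  · intro h
    unfold psi rho t1 t2 u1 u2
    -- The summands are rotated so that the next infimum comes first; those already evaluated move
    -- to the back.
    rw [show ∀ e a b c d : EReal, e + (a + b + c + d) = a + (b + (c + (d + e))) by
      intros; ac_rfl]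
    refine le_infPos_add ?_ fun x₁ h₁ => ?_
    · exact EReal.add_ne_top (infPos_ne_top _) (EReal.add_ne_top (infPos_ne_top _)
        (EReal.add_ne_top (infPos_ne_top _) (EReal.coe_ne_top _)))
    rw [show ∀ e a b c d : EReal, a + (b + (c + (d + e))) = b + (c + (d + (a + e))) by
      intros; ac_rfl]
    refine le_infPos_add ?_ fun x₂ h₂ => ?_
    · exact EReal.add_ne_top (infPos_ne_top _) (EReal.add_ne_top (infPos_ne_top _)
        (EReal.add_ne_top (EReal.coe_ne_top _) (EReal.coe_ne_top _)))
    rw [show ∀ e b c d : EReal, b + (c + (d + e)) = c + (d + (b + e)) by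
      intros; ac_rfl]
    refine le_infPos_add ?_ fun x₃ h₃ => ?_
    · refine EReal.add_ne_top (infPos_ne_top _) ?_
      rw [← EReal.coe_add, ← EReal.coe_add]
      exact EReal.coe_ne_top _
    rw [show ∀ e c d : EReal, c + (d + e) = d + (c + e) by
      intros; ac_rfl]
    refine le_infPos_add ?_ fun x₄ h₄ => ?_
    · rw [← EReal.coe_add, ← EReal.coe_add, ← EReal.coe_add]
      exact EReal.coe_ne_top _
    refine (h x₁ h₁ x₂ h₂ x₃ h₃ x₄ h₄).trans_eq ?_
    simp only [← EReal.coe_add]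
    congr 1
    unfold psiAt rhoAt entropyPart
    ring

lemma psi_le_psiAt (c d t c₁ : ℕ) (α γ δ φ ω : ℝ) {x₁ x₂ x₃ x₄ : ℝ} (h₁ : 0 < x₁) (h₂ : 0 < x₂)
    (h₃ : 0 < x₃) (h₄ : 0 < x₄) :
    psi c d t c₁ α γ δ φ ω ≤ (psiAt c d t c₁ α γ δ φ ω x₁ x₂ x₃ x₄ : ℝ) :=
  le_psi_iff.1 le_rfl x₁ h₁ x₂ h₂ x₃ h₃ x₄ h₄

lemma exists_psiAt_lt {c d t c₁ : ℕ} {α γ δ φ ω r : ℝ} (h : psi c d t c₁ α γ δ φ ω < (r : EReal)) :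
    ∃ x₁ > 0, ∃ x₂ > 0, ∃ x₃ > 0, ∃ x₄ > 0, psiAt c d t c₁ α γ δ φ ω x₁ x₂ x₃ x₄ < r := by
  by_contra! hcon
  exact absurd h (not_lt.2 (le_psi_iff.2 fun x₁ h₁ x₂ h₂ x₃ h₃ x₄ h₄ =>
    EReal.coe_le_coe_iff.2 (hcon x₁ h₁ x₂ h₂ x₃ h₃ x₄ h₄)))

lemma psi_le_f {c d t c₁ : ℕ} {α γ δ φ ω : ℝ} (h : Feasible c d t c₁ α γ δ φ ω) :
    psi c d t c₁ α γ δ φ ω ≤ f c d t c₁ α :=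
  le_sSup ⟨γ, δ, φ, ω, h, rfl⟩

/-! ### Values of the polynomials -/

lemma sum_choose_mul_pow_le_two_pow (n : ℕ) (s : Finset ℕ) :
    ∑ j ∈ s, (n.choose j : ℝ) ≤ 2 ^ n := by
  classical
  have h1 : ∑ j ∈ s, (n.choose j : ℝ) ≤ ∑ j ∈ s ∪ Finset.range (n + 1), (n.choose j : ℝ) :=
    Finset.sum_le_sum_of_subset_of_nonneg Finset.subset_union_left fun _ _ _ => by positivity
  have h2 : ∑ j ∈ s ∪ Finset.range (n + 1), (n.choose j : ℝ)
      = ∑ j ∈ Finset.range (n + 1), (n.choose j : ℝ) := by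
    symm
    refine Finset.sum_subset Finset.subset_union_right fun j _ hj => ?_
    rw [Finset.mem_range, not_lt] at hj
    rw [Nat.choose_eq_zero_of_lt (by omega), Nat.cast_zero]
  rw [h2] at h1
  refine h1.trans_eq ?_
  exact_mod_cast Nat.sum_range_choose n

lemma F0_pos {c c₁ : ℕ} (h₁ : 1 ≤ c₁) (h : c₁ ≤ c) {x : ℝ} (hx : 0 < x) : 0 < F0 c c₁ x :=
  Finset.sum_pos (fun j hj => mul_pos
    (Nat.cast_pos.2 (Nat.choose_pos (Finset.mem_Icc.1 hj).2)) (pow_pos hx j))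
    ⟨c, Finset.mem_Icc.2 ⟨by omega, le_rfl⟩⟩

lemma F1_pos {c c₁ : ℕ} {x : ℝ} (hx : 0 < x) : 0 < F1 c c₁ x :=
  Finset.sum_pos (fun j hj => mul_pos
    (Nat.cast_pos.2 (Nat.choose_pos ((Finset.mem_Icc.1 hj).2.trans (Nat.sub_le _ _))))
      (pow_pos hx j)) ⟨0, Finset.mem_Icc.2 ⟨le_rfl, by omega⟩⟩

lemma F2_pos {c c₁ : ℕ} (h : c₁ ≤ c) {x : ℝ} (hx : 0 < x) : 0 < F2 c c₁ x :=
  Finset.sum_pos (fun j hj => mul_pos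
    (Nat.cast_pos.2 (Nat.choose_pos (Finset.mem_Icc.1 hj).2)) (pow_pos hx j))
    ⟨c, Finset.mem_Icc.2 ⟨h, le_rfl⟩⟩

lemma one_le_sum_Icc_zero (n m : ℕ) {x : ℝ} (hx : 0 ≤ x) :
    1 ≤ ∑ j ∈ Finset.Icc 0 m, (n.choose j : ℝ) * x ^ j := by
  have := Finset.single_le_sum (f := fun j => (n.choose j : ℝ) * x ^ j)
    (fun j _ => by positivity) (Finset.mem_Icc.2 ⟨le_rfl, Nat.zero_le m⟩)
  simpa using this

lemma one_le_F3 (c c₁ : ℕ) {x : ℝ} (hx : 0 ≤ x) : 1 ≤ F3 c c₁ x := one_le_sum_Icc_zero c _ hx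

lemma one_le_G1 (d t : ℕ) {x : ℝ} (hx : 0 ≤ x) : 1 ≤ G1 d t x := one_le_sum_Icc_zero d _ hx

lemma G0_pos {d t : ℕ} (h : t < d) {x : ℝ} (hx : 0 < x) : 0 < G0 d t x :=
  Finset.sum_pos (fun j hj => mul_pos
    (Nat.cast_pos.2 (Nat.choose_pos (Finset.mem_Icc.1 hj).2)) (pow_pos hx j))
    ⟨d, Finset.mem_Icc.2 ⟨h, le_rfl⟩⟩

/-- The constant term is `1`, every other monomial is at most `x`, and `log (1 + y) ≤ y`. -/
lemma log_sum_Icc_zero_le (n m : ℕ) {x : ℝ} (hx : 0 < x) (hx1 : x ≤ 1) :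
    Real.log (∑ j ∈ Finset.Icc 0 m, (n.choose j : ℝ) * x ^ j) ≤ 2 ^ n * x := by
  have h0 := one_le_sum_Icc_zero n m hx.le
  refine (Real.log_le_sub_one_of_pos (by linarith)).trans ?_
  rw [sub_le_iff_le_add]
  rw [← Finset.insert_Icc_succ_left_eq_Icc (Nat.zero_le m), Finset.sum_insert (by simp)]
  simp only [Nat.choose_zero_right, Nat.cast_one, pow_zero, mul_one]
  rw [add_comm]
  gcongr
  calc ∑ j ∈ Finset.Icc (Order.succ 0) m, (n.choose j : ℝ) * x ^ j
      ≤ ∑ j ∈ Finset.Icc (Order.succ 0) m, (n.choose j : ℝ) * x := by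
        refine Finset.sum_le_sum fun j hj => ?_
        gcongr
        refine pow_le_of_le_one hx.le hx1 ?_
        have := (Finset.mem_Icc.1 hj).1
        simp at this
        omega
    _ = (∑ j ∈ Finset.Icc (Order.succ 0) m, (n.choose j : ℝ)) * x := by rw [Finset.sum_mul]
    _ ≤ 2 ^ n * x := by
        gcongr
        exact sum_choose_mul_pow_le_two_pow _ _

lemma log_F2_le {c c₁ : ℕ} (h : c₁ ≤ c) {x : ℝ} (hx : 0 < x) (hx1 : x ≤ 1) :
    Real.log (F2 c c₁ x) ≤ c * Real.log 2 + c₁ * Real.log x := by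
  rw [← Real.log_pow, ← Real.log_pow, ← Real.log_mul (by positivity) (by positivity)]
  refine Real.log_le_log (F2_pos h hx) ?_
  calc F2 c c₁ x ≤ ∑ j ∈ Finset.Icc c₁ c, (c.choose j : ℝ) * x ^ c₁ := by
        refine Finset.sum_le_sum fun j hj => ?_
        gcongr ?_ * ?_
        exact pow_le_pow_of_le_one hx.le hx1 (Finset.mem_Icc.1 hj).1
    _ = (∑ j ∈ Finset.Icc c₁ c, (c.choose j : ℝ)) * x ^ c₁ := by rw [Finset.sum_mul]
    _ ≤ 2 ^ c * x ^ c₁ := by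
        gcongr
        exact sum_choose_mul_pow_le_two_pow _ _

/-! ### Consequences of the threshold condition and of feasibility -/

lemma ThresholdCondition.lt {c t c₁ : ℕ} (h : ThresholdCondition c t c₁) : c₁ < c := by
  by_contra! hc
  have h1 : (c : ℝ) ≤ c₁ := by exact_mod_cast hc
  have h2 : (t : ℝ) / (t + 1) ≤ 1 := by
    rw [div_le_one (by positivity)]
    linarith
  have h3 : 0 ≤ (t : ℝ) / (t + 1) := by positivity
  have := h.2
  nlinarith

namespace Feasible

variable {c d t c₁ : ℕ} {α γ δ φ ω : ℝ}

lemma omega_nonneg' (h : Feasible c d t c₁ α γ δ φ ω) (hc : 0 < c) : 0 ≤ ω :=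
  nonneg_of_mul_nonneg_left h.omega_nonneg (by exact_mod_cast hc)

lemma omega_le_min (h : Feasible c d t c₁ α γ δ φ ω) (hc : 0 < c) : ω ≤ min α φ :=
  le_of_mul_le_mul_right h.omega_le (by exact_mod_cast hc)

lemma sub_omega_le (h : Feasible c d t c₁ α γ δ φ ω) (hc : 0 < c) : α - ω ≤ 1 - φ :=
  le_of_mul_le_mul_right h.edges_le (by exact_mod_cast hc)

/-- Feasibility makes every parameter `O(α)`. This bounds the error terms as `α → 0` and makes the
feasible set bounded. -/
lemma phi_le_mul (h : Feasible c d t c₁ α γ δ φ ω) (hc : 0 < c) : φ ≤ d * α := by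
  have h0 := h.omega_nonneg' hc
  have h1 := (h.omega_le_min hc).trans (min_le_left _ _)
  calc φ ≤ ω * d / (t + 1) := h.phi_le
    _ ≤ ω * d := div_le_self (by positivity) (by linarith [(Nat.cast_nonneg t : (0 : ℝ) ≤ t)])
    _ ≤ d * α := by rw [mul_comm]; gcongr

lemma delta_le_mul (h : Feasible c d t c₁ α γ δ φ ω) (hc : 0 < c) (h₁ : 1 ≤ c₁) :
    δ ≤ c * d * α := by
  have h0 := h.omega_nonneg' hc
  have h2 := (h.omega_le_min hc).trans (min_le_right _ _)
  have h3 : (1 : ℝ) ≤ c₁ := by exact_mod_cast h₁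
  calc δ ≤ (φ - ω) * c / c₁ := h.delta_le'
    _ ≤ (φ - ω) * c := div_le_self (mul_nonneg (by linarith) (by positivity)) h3
    _ ≤ (d * α) * c := by gcongr; linarith [h.phi_le_mul hc]
    _ = c * d * α := by ring

end Feasible

end

noncomputable section

/-! ### The exponent for small `α` -/

/-- For `y = O(α)` this separates the leading term of order `-α log α` from a remainder of order
`α`. -/
lemma negMulLog_eq_scaled {α : ℝ} (hα : 0 < α) (y : ℝ) :
    Real.negMulLog y = y * -Real.log α + α * Real.negMulLog (y / α) := by
  conv_lhs => rw [show y = y / α * α by field_simp]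
  rw [Real.negMulLog_mul, Real.negMulLog]
  field_simp
  rw [Real.negMulLog]
  ring

lemma negMulLog_le_scaled {α y : ℝ} (hα : 0 < α) (hy : 0 ≤ y) :
    Real.negMulLog y ≤ y * -Real.log α + α := by
  rw [negMulLog_eq_scaled hα]
  have h0 : 0 ≤ y / α := by positivity
  have := Real.negMulLog_le_one_sub_self h0
  nlinarith

lemma scaled_le_negMulLog {α y K : ℝ} (hα : 0 < α) (hy : 0 ≤ y) (hyK : y ≤ K * α) :
    y * -Real.log α - K ^ 2 * α ≤ Real.negMulLog y := by
  rw [negMulLog_eq_scaled hα]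
  have h0 : 0 ≤ y / α := by positivity
  have h1 : y / α ≤ K := by rwa [div_le_iff₀ hα]
  have h2 : -(K ^ 2) ≤ Real.negMulLog (y / α) := by
    rcases h0.eq_or_lt with h | h
    · rw [← h]
      simp only [Real.negMulLog_zero]
      nlinarith [sq_nonneg K]
    · have := Real.log_le_sub_one_of_pos h
      rw [Real.negMulLog]
      nlinarith
  nlinarith

lemma negMulLog_one_sub_le {z : ℝ} (hz : z ≤ 1) : Real.negMulLog (1 - z) ≤ z := by
  have := Real.negMulLog_le_one_sub_self (sub_nonneg.2 hz)
  linarith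

variable {c d t c₁ : ℕ}

/-- Each of the small entropy arguments contributes itself times `-log α`, up to `O(α)`; terms of
the form `negMulLog (1 - z)` are `O(α)` from above, and the one with a negative sign is dropped
because it is nonnegative. -/
lemma entropyPart_le (hc : 0 < c) (hd : 0 < d) (h₁ : 1 ≤ c₁) {α γ δ φ ω : ℝ} (hα : 0 < α)
    (h : Feasible c d t c₁ α γ δ φ ω) :
    entropyPart c d α γ δ φ ω ≤
      -Real.log α * (α + δ + (c : ℝ) / d * φ - c * (α + φ - ω))
        + (4 + c * d + c * (1 + d) + c * (2 + d ^ 2)) * α := by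
  have hω0 := h.omega_nonneg' hc
  have hωα := (h.omega_le_min hc).trans (min_le_left _ _)
  have hωφ := (h.omega_le_min hc).trans (min_le_right _ _)
  have hφ := h.phi_le_mul hc
  have hδ := h.delta_le_mul hc h₁
  have hsub := h.sub_omega_le hc
  have hg := h.gamma_nonneg
  have hg' := h.gamma_le
  have hδ0 := h.delta_nonneg
  have hδ1 := h.delta_le
  have hcR : (1 : ℝ) ≤ c := by exact_mod_cast hc
  have hdR : (1 : ℝ) ≤ d := by exact_mod_cast hd
  have e1 := negMulLog_le_scaled hα hg
  have e2 := negMulLog_le_scaled hα (sub_nonneg.2 hg')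
  have e3 := negMulLog_le_scaled hα hδ0
  have e4 : Real.negMulLog (1 - (γ + (α - γ) + δ)) ≤ γ + (α - γ) + δ :=
    negMulLog_one_sub_le (by linarith)
  have e5 := negMulLog_le_scaled hα (hω0.trans hωφ)
  have e6 : Real.negMulLog (1 - φ) ≤ φ := negMulLog_one_sub_le (by linarith)
  have e7 := scaled_le_negMulLog (K := 1) hα hω0 (by linarith)
  have e8 := scaled_le_negMulLog (K := 1) hα (sub_nonneg.2 hωα) (by linarith)
  have e9 := scaled_le_negMulLog (K := d) hα (sub_nonneg.2 hωφ) (by linarith)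
  have e10 : 0 ≤ Real.negMulLog (1 - (ω + (α - ω) + (φ - ω))) :=
    Real.negMulLog_nonneg (by linarith) (by linarith)
  have hcd : (c : ℝ) / d ≤ c := div_le_self (by positivity) hdR
  simp only [entropyPart, entropy, Fin.sum_univ_three, Fin.sum_univ_one, Matrix.cons_val_zero,
    Matrix.cons_val_one, Matrix.cons_val, Matrix.cons_val_fin_one]
  have m1 : (c : ℝ) / d * (Real.negMulLog φ + Real.negMulLog (1 - φ))
      ≤ (c : ℝ) / d * φ * -Real.log α + c * (1 + d) * α := by
    calc _ ≤ (c : ℝ) / d * (φ * -Real.log α + α + φ) := by gcongr ?_ * ?_; linarith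
      _ = (c : ℝ) / d * φ * -Real.log α + (c : ℝ) / d * (α + φ) := by ring
      _ ≤ (c : ℝ) / d * φ * -Real.log α + c * (α + d * α) := by
        gcongr
        linarith
      _ = _ := by ring
  have m2 : (c : ℝ) * (ω * -Real.log α - 1 ^ 2 * α + ((α - ω) * -Real.log α - 1 ^ 2 * α)
      + ((φ - ω) * -Real.log α - d ^ 2 * α))
      ≤ c * (Real.negMulLog ω + Real.negMulLog (α - ω) + Real.negMulLog (φ - ω)
        + Real.negMulLog (1 - (ω + (α - ω) + (φ - ω)))) := by
    refine mul_le_mul_of_nonneg_left ?_ (by positivity)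
    linarith
  nlinarith

/-- The value of `rhoAt` at `x₁ = x₃ = 1` and `x₂ = x₄ = α`. -/
lemma rhoAt_le (hc : 0 < c) (hd : 0 < d) (h₁ : 1 ≤ c₁) (hcc : c₁ ≤ c) {α γ δ φ ω : ℝ} (hα : 0 < α)
    (hα1 : α ≤ 1) (h : Feasible c d t c₁ α γ δ φ ω) :
    rhoAt c d t c₁ α γ δ φ ω 1 α 1 α ≤
      -Real.log α * (c * (α + φ - 2 * ω) - c₁ * δ)
        + (|Real.log (F0 c c₁ 1)| + |Real.log (F1 c c₁ 1)| + c * |Real.log (G0 d t 1)|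
          + c * d * (c * Real.log 2) + 2 ^ c + c * 2 ^ d) * α := by
  have hω0 := h.omega_nonneg' hc
  have hωα := (h.omega_le_min hc).trans (min_le_left _ _)
  have hωφ := (h.omega_le_min hc).trans (min_le_right _ _)
  have hφ := h.phi_le_mul hc
  have hδ := h.delta_le_mul hc h₁
  have hsub := h.sub_omega_le hc
  have hg := h.gamma_nonneg
  have hg' := h.gamma_le
  have hδ0 := h.delta_nonneg
  have hδ1 := h.delta_le
  have hcR : (1 : ℝ) ≤ c := by exact_mod_cast hc
  have hdR : (1 : ℝ) ≤ d := by exact_mod_cast hd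
  have e1 : γ * Real.log (F0 c c₁ 1) ≤ α * |Real.log (F0 c c₁ 1)| :=
    (mul_le_mul_of_nonneg_left (le_abs_self _) hg).trans
      (mul_le_mul_of_nonneg_right hg' (abs_nonneg _))
  have e2 : (α - γ) * Real.log (F1 c c₁ 1) ≤ α * |Real.log (F1 c c₁ 1)| :=
    (mul_le_mul_of_nonneg_left (le_abs_self _) (sub_nonneg.2 hg')).trans
      (mul_le_mul_of_nonneg_right (by linarith) (abs_nonneg _))
  have hφc : φ * c / d ≤ c * α := by
    rw [div_le_iff₀ (by linarith)]
    nlinarith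
  have hφ0 : 0 ≤ φ * c / d := div_nonneg (mul_nonneg (by linarith) (by linarith)) (by linarith)
  have e3 : φ * c / d * Real.log (G0 d t 1) ≤ c * α * |Real.log (G0 d t 1)| :=
    (mul_le_mul_of_nonneg_left (le_abs_self _) hφ0).trans
      (mul_le_mul_of_nonneg_right hφc (abs_nonneg _))
  have hlog2 : 0 ≤ Real.log 2 := Real.log_nonneg (by norm_num)
  have e4 : δ * Real.log (F2 c c₁ α) ≤ c * d * α * (c * Real.log 2) + δ * (c₁ * Real.log α) := by
    have := mul_le_mul_of_nonneg_left (log_F2_le hcc hα hα1) hδ0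
    have h2 := mul_le_mul_of_nonneg_right hδ (by positivity : 0 ≤ c * Real.log 2)
    linarith
  have e5 : (1 - α - δ) * Real.log (F3 c c₁ α) ≤ 2 ^ c * α := by
    calc _ ≤ (1 - α - δ) * (2 ^ c * α) :=
          mul_le_mul_of_nonneg_left (log_sum_Icc_zero_le c _ hα hα1) (by linarith)
      _ ≤ 1 * (2 ^ c * α) := by gcongr; linarith
      _ = _ := one_mul _
  have e6 : (1 - φ) * c / d * Real.log (G1 d t α) ≤ c * (2 ^ d * α) := by
    have h0 : 0 ≤ (1 - φ) * c := mul_nonneg (by linarith) (by linarith)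
    calc _ ≤ (1 - φ) * c / d * (2 ^ d * α) :=
          mul_le_mul_of_nonneg_left (log_sum_Icc_zero_le d _ hα hα1)
            (div_nonneg h0 (by linarith))
      _ ≤ c * (2 ^ d * α) := by
          gcongr
          refine (div_le_self h0 hdR).trans ?_
          nlinarith
  simp only [rhoAt, Real.log_one, mul_zero, sub_zero]
  linarith

/-- The slope of the exponent at `0` is `-∞` because of the threshold condition. -/
lemma bracket_le (hT : ThresholdCondition c t c₁) (ht : 0 < t) {α γ δ φ ω : ℝ}
    (h : Feasible c d t c₁ α γ δ φ ω) :
    α - (c₁ - 1) * δ + (c : ℝ) / d * φ - c * ω ≤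
      -((1 - (((c : ℝ) - c₁ + 1) * ((t : ℝ) / (t + 1)))⁻¹) / (1 + d)) * α := by
  have hcc := hT.lt
  have hc : 0 < c := by omega
  have hω0 := h.omega_nonneg' hc
  have hωφ := (h.omega_le_min hc).trans (min_le_right _ _)
  have hcR : (1 : ℝ) ≤ c := by exact_mod_cast hc
  have htR : (1 : ℝ) ≤ t := by exact_mod_cast ht
  have h₁ : (2 : ℝ) ≤ c₁ := by exact_mod_cast hT.1
  have hccR : (c₁ : ℝ) + 1 ≤ c := by exact_mod_cast hcc
  have hdR : (0 : ℝ) ≤ d := by positivity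
  set lam : ℝ := ((c : ℝ) - c₁ + 1) * ((t : ℝ) / (t + 1)) with hlam
  have hlam1 : 1 < lam := hT.2
  -- `W` measures all the other quantities: the bound on `φ` gives `(c / d) φ - c ω ≤ -W`, while `γ
  -- ≤ W / lam` and `δ ≤ d W`. As `c₁ ≥ 2`, `α - (c₁ - 1) δ ≤ α - δ ≤ γ`, so the form is at most
  -- `-(1 - 1 / lam) W`, and `α ≤ γ + δ ≤ (1 + d) W`.
  set W : ℝ := c * ω * (t / (t + 1)) with hW
  have hW0 : 0 ≤ W := by positivity
  have hγW : lam * γ ≤ W := by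
    have := h.gamma_le'
    rw [le_div_iff₀ (by linarith)] at this
    calc lam * γ = γ * (c - c₁ + 1) * (t / (t + 1)) := by rw [hlam]; ring
      _ ≤ ω * c * (t / (t + 1)) := by gcongr
      _ = W := by rw [hW]; ring
  have hδW : δ ≤ d * W := by
    have h1 : δ ≤ (φ - ω) * c :=
      h.delta_le'.trans (div_le_self (mul_nonneg (by linarith) (by positivity)) (by linarith))
    have h2 : φ - ω ≤ d * (ω * (t / (t + 1))) := by
      have h3 : ω * d / (t + 1) ≤ d * (ω * (t / (t + 1))) := by
        rw [div_le_iff₀ (by positivity)]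
        field_simp
        nlinarith [mul_nonneg hω0 hdR]
      linarith [h.phi_le]
    calc δ ≤ (φ - ω) * c := h1
      _ ≤ d * (ω * (t / (t + 1))) * c := by gcongr
      _ = d * W := by rw [hW]; ring
  have hφW : (c : ℝ) / d * φ ≤ c * ω - W := by
    have h1 : (c : ℝ) / d * φ ≤ c / d * (ω * d / (t + 1)) := by
      gcongr
      exact h.phi_le
    refine h1.trans ?_
    rcases hdR.eq_or_lt with h0 | h0
    · rw [← h0, hW]
      simp only [div_zero, zero_mul]
      rw [sub_nonneg]
      exact mul_le_of_le_one_right (by positivity) ((div_le_one (by positivity)).2 (by linarith))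
    · rw [hW]
      apply le_of_eq
      field_simp
      ring
  have hγ' : γ ≤ lam⁻¹ * W := by
    rw [inv_mul_eq_div, le_div_iff₀ (by linarith)]
    linarith
  have hinv : lam⁻¹ < 1 := inv_lt_one_of_one_lt₀ hlam1
  have hα : α ≤ (1 + d) * W := by
    have := h.bad
    nlinarith
  have hδ : δ ≤ (c₁ - 1) * δ := by
    have := h.delta_nonneg
    nlinarith
  have h1 : α - (c₁ - 1) * δ + (c : ℝ) / d * φ - c * ω ≤ -((1 - lam⁻¹) * W) := by
    have := h.bad
    linarith
  refine h1.trans ?_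
  rw [neg_mul, neg_le_neg_iff, div_mul_eq_mul_div, div_le_iff₀ (by positivity), mul_assoc]
  refine mul_le_mul_of_nonneg_left ?_ (by linarith)
  linarith

/-- `f` lies below every line through the origin near `0`. -/
lemma exists_forall_f_le_neg_mul (hT : ThresholdCondition c t c₁) (ht : 0 < t) (hd : 0 < d) (M : ℝ) :
    ∃ ε > 0, ∀ α, 0 < α → α < ε → f c d t c₁ α ≤ ((-M * α : ℝ) : EReal) := by
  have hcc := hT.lt
  have hc : 0 < c := by omega
  have h₁ : 1 ≤ c₁ := by linarith [hT.1]
  set κ : ℝ := (1 - (((c : ℝ) - c₁ + 1) * ((t : ℝ) / (t + 1)))⁻¹) / (1 + d) with hκ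
  have hκ0 : 0 < κ := by
    have := inv_lt_one_of_one_lt₀ hT.2
    rw [hκ]
    apply div_pos <;> [linarith; positivity]
  set C : ℝ := (4 + c * d + c * (1 + d) + c * (2 + d ^ 2)) +
    (|Real.log (F0 c c₁ 1)| + |Real.log (F1 c c₁ 1)| + c * |Real.log (G0 d t 1)|
          + c * d * (c * Real.log 2) + 2 ^ c + c * 2 ^ d) with hC
  -- Below this threshold `-κ log α ≥ C + M`, which absorbs the `O(α)` constant `C` and leaves slope
  -- `-M`.
  refine ⟨min 1 (Real.exp (-((C + M) / κ))), by positivity, fun α hα hαε => ?_⟩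
  have hα1 : α ≤ 1 := (hαε.trans_le (min_le_left _ _)).le
  have hlog : (C + M) / κ ≤ -Real.log α := by
    have := Real.log_le_log hα (hαε.trans_le (min_le_right _ _)).le
    rw [Real.log_exp] at this
    linarith
  refine sSup_le ?_
  rintro _ ⟨γ, δ, φ, ω, hF, rfl⟩
  -- The variables `x₂`, `x₄` go with `F3` and `G1`, whose coefficients need not be small. Taking
  -- them equal to `α` makes those logarithms `O(α)`. The `-log α` terms of entropy and `rhoAt` then
  -- add up to the form in `bracket_le`.
  refine (psi_le_psiAt c d t c₁ α γ δ φ ω one_pos hα one_pos hα).trans ?_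
  rw [EReal.coe_le_coe_iff]
  have e1 := entropyPart_le hc hd h₁ hα hF
  have e2 := rhoAt_le hc hd h₁ hcc.le hα hα1 hF
  have e3 := bracket_le hT ht hF
  rw [← hκ] at e3
  have hL : 0 ≤ -Real.log α := neg_nonneg.2 (Real.log_nonpos hα.le hα1)
  have e4 := mul_le_mul_of_nonneg_left e3 hL
  rw [div_le_iff₀ hκ0] at hlog
  have e5 := mul_le_mul_of_nonneg_right hlog hα.le
  unfold psiAt
  nlinarith

/-! ### The smallest positive root -/

lemma isCompact_feasible (hT : ThresholdCondition c t c₁) (a b : ℝ) :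
    IsCompact {p : ℝ × ℝ × ℝ × ℝ × ℝ | a ≤ p.1 ∧ p.1 ≤ b ∧
      Feasible c d t c₁ p.1 p.2.1 p.2.2.1 p.2.2.2.1 p.2.2.2.2} := by
  have hc : 0 < c := by linarith [hT.lt]
  have h₁ : 1 ≤ c₁ := by linarith [hT.1]
  have hsub : {p : ℝ × ℝ × ℝ × ℝ × ℝ | a ≤ p.1 ∧ p.1 ≤ b ∧
      Feasible c d t c₁ p.1 p.2.1 p.2.2.1 p.2.2.2.1 p.2.2.2.2} ⊆
      Set.Icc a b ×ˢ Set.Icc 0 b ×ˢ Set.Icc 0 (c * d * b) ×ˢ Set.Icc 0 (d * b) ×ˢ Set.Icc 0 b := by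
    rintro ⟨α, γ, δ, φ, ω⟩ ⟨ha, hb, h⟩
    simp only at ha hb h
    have e1 := h.omega_nonneg' hc
    have e2 := h.omega_le_min hc
    have e3 := e2.trans (min_le_left _ _)
    have e4 := e2.trans (min_le_right _ _)
    have e5 := h.phi_le_mul hc
    have e6 := h.delta_le_mul hc h₁
    refine ⟨⟨ha, hb⟩, ⟨h.gamma_nonneg, h.gamma_le.trans hb⟩, ⟨h.delta_nonneg, e6.trans ?_⟩,
      ⟨e1.trans e4, e5.trans ?_⟩, e1, e3.trans hb⟩ <;> gcongr
  refine (isCompact_Icc.prod (isCompact_Icc.prod (isCompact_Icc.prod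
    (isCompact_Icc.prod isCompact_Icc)))).of_isClosed_subset ?_ hsub
  have hset : {p : ℝ × ℝ × ℝ × ℝ × ℝ | a ≤ p.1 ∧ p.1 ≤ b ∧
      Feasible c d t c₁ p.1 p.2.1 p.2.2.1 p.2.2.2.1 p.2.2.2.2} =
      {p | a ≤ p.1} ∩ {p | p.1 ≤ b} ∩ {p | p.1 - p.2.1 ≤ p.2.2.1} ∩ {p | 0 ≤ p.2.1} ∩
      {p | p.2.1 ≤ p.1} ∩ {p | 0 ≤ p.2.2.1} ∩ {p | p.2.2.1 ≤ 1 - p.1} ∩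
      {p | 0 ≤ p.2.2.2.2 * (c : ℝ)} ∩ {p | p.2.2.2.2 * (c : ℝ) ≤ min p.1 p.2.2.2.1 * (c : ℝ)} ∩
      {p | (p.1 - p.2.2.2.2) * (c : ℝ) ≤ (1 - p.2.2.2.1) * (c : ℝ)} ∩
      {p | p.2.2.2.1 ≤ p.2.2.2.2 * (d : ℝ) / ((t : ℝ) + 1)} ∩
      {p | p.2.2.1 ≤ (p.2.2.2.1 - p.2.2.2.2) * (c : ℝ) / (c₁ : ℝ)} ∩
      {p | p.2.1 ≤ p.2.2.2.2 * (c : ℝ) / ((c : ℝ) - c₁ + 1)} := by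
    ext p
    simp only [Set.mem_ofPred_eq, Set.mem_inter_iff]
    constructor
    · rintro ⟨h1, h2, ⟨⟩⟩
      tauto
    · intro h
      exact ⟨by tauto, by tauto, by constructor <;> tauto⟩
  rw [hset]
  repeat' apply IsClosed.inter
  all_goals exact isClosed_le (by fun_prop) (by fun_prop)

/-- For fixed `x₁, …, x₄` the function `psiAt` is continuous in the parameters, and an infimum of
continuous functions is upper semicontinuous. -/
lemma upperSemicontinuous_psi : UpperSemicontinuous fun p : ℝ × ℝ × ℝ × ℝ × ℝ =>
    psi c d t c₁ p.1 p.2.1 p.2.2.1 p.2.2.2.1 p.2.2.2.2 := by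
  rw [upperSemicontinuous_iff_isClosed_preimage]
  intro r
  have : (fun p : ℝ × ℝ × ℝ × ℝ × ℝ => psi c d t c₁ p.1 p.2.1 p.2.2.1 p.2.2.2.1 p.2.2.2.2) ⁻¹'
      Set.Ici r = ⋂ x₁ > 0, ⋂ x₂ > 0, ⋂ x₃ > 0, ⋂ x₄ > 0,
        {p | r ≤ (psiAt c d t c₁ p.1 p.2.1 p.2.2.1 p.2.2.2.1 p.2.2.2.2 x₁ x₂ x₃ x₄ : ℝ)} := by
    ext p
    simp only [Set.mem_preimage, Set.mem_Ici, le_psi_iff, Set.mem_iInter, Set.mem_ofPred_eq]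
  rw [this]
  refine isClosed_iInter fun x₁ => isClosed_iInter fun _ => isClosed_iInter fun x₂ =>
    isClosed_iInter fun _ => isClosed_iInter fun x₃ => isClosed_iInter fun _ =>
    isClosed_iInter fun x₄ => isClosed_iInter fun _ => ?_
  refine isClosed_le continuous_const (continuous_coe_real_ereal.comp ?_)
  simp only [psiAt, rhoAt, entropyPart, entropy, Fin.sum_univ_three, Fin.sum_univ_one,
    Matrix.cons_val_zero, Matrix.cons_val_one, Matrix.cons_val, Matrix.cons_val_fin_one]
  fun_prop

/-- The set of the `α` at which `f` is nonnegative is closed. -/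
lemma isCompact_nonneg_f (hT : ThresholdCondition c t c₁) (a b : ℝ) :
    IsCompact {α : ℝ | a ≤ α ∧ α ≤ b ∧ ∃ γ δ φ ω, Feasible c d t c₁ α γ δ φ ω ∧
      0 ≤ psi c d t c₁ α γ δ φ ω} := by
  have h := ((isCompact_feasible (d := d) hT a b).inter_right
    (upperSemicontinuous_iff_isClosed_preimage.1 (upperSemicontinuous_psi (c := c) (d := d) (t := t)
      (c₁ := c₁)) 0)).image continuous_fst
  convert h using 1
  ext α
  simp only [Set.mem_ofPred_eq, Set.mem_image, Set.mem_inter_iff, Set.mem_preimage, Set.mem_Ici,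
    Prod.exists, exists_and_right, exists_eq_right]
  constructor
  · rintro ⟨ha, hb, γ, δ, φ, ω, hF, hp⟩
    exact ⟨γ, δ, φ, ω, ⟨ha, hb, hF⟩, hp⟩
  · rintro ⟨γ, δ, φ, ω, ⟨ha, hb, hF⟩, hp⟩
    exact ⟨ha, hb, γ, δ, φ, ω, hF, hp⟩

/-- Where the maximum of `psi` is negative, so is its supremum, uniformly on compact intervals. -/
lemma exists_forall_f_le (hT : ThresholdCondition c t c₁) {a b : ℝ}
    (h : ∀ α, a ≤ α → α ≤ b → ∀ γ δ φ ω, Feasible c d t c₁ α γ δ φ ω →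
      psi c d t c₁ α γ δ φ ω < 0) :
    ∃ η > 0, ∀ α, a ≤ α → α ≤ b → f c d t c₁ α ≤ ((-η : ℝ) : EReal) := by
  set K := {p : ℝ × ℝ × ℝ × ℝ × ℝ | a ≤ p.1 ∧ p.1 ≤ b ∧
      Feasible c d t c₁ p.1 p.2.1 p.2.2.1 p.2.2.2.1 p.2.2.2.2} with hK
  rcases K.eq_empty_or_nonempty with hE | hE
  · refine ⟨1, one_pos, fun α ha hb => sSup_le ?_⟩
    rintro _ ⟨γ, δ, φ, ω, hF, rfl⟩
    have : (α, γ, δ, φ, ω) ∈ K := ⟨ha, hb, hF⟩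
    simp [hE] at this
  · obtain ⟨p, hp, hmax⟩ := UpperSemicontinuousOn.exists_isMaxOn hE
      (isCompact_feasible (d := d) hT a b) ((upperSemicontinuous_psi (c := c) (d := d) (t := t)
      (c₁ := c₁)).upperSemicontinuousOn _)
    have hneg := h p.1 hp.1 hp.2.1 _ _ _ _ hp.2.2
    obtain ⟨r, hr1, hr2⟩ := EReal.lt_iff_exists_real_btwn.1 hneg
    refine ⟨-r, by simpa using hr2, fun α ha hb => sSup_le ?_⟩
    rintro _ ⟨γ, δ, φ, ω, hF, rfl⟩
    rw [neg_neg]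
    exact (hmax (show (α, γ, δ, φ, ω) ∈ K from ⟨ha, hb, hF⟩)).trans hr1.le

lemma feasible_one (hT : ThresholdCondition c t c₁) (htd : t < d) :
    Feasible c d t c₁ 1 1 0 1 1 := by
  have hcc : (c₁ : ℝ) < c := by exact_mod_cast hT.lt
  have h₁ : (2 : ℝ) ≤ c₁ := by exact_mod_cast hT.1
  have hd : (t : ℝ) + 1 ≤ d := by exact_mod_cast htd
  constructor <;> try norm_num
  · rw [le_div_iff₀ (by positivity)]
    linarith
  · rw [le_div_iff₀ (by linarith)]
    linarith

lemma pow_le_sum_Icc (n m : ℕ) (h : m ≤ n) {x : ℝ} (hx : 0 ≤ x) :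
    x ^ n ≤ ∑ j ∈ Finset.Icc m n, (n.choose j : ℝ) * x ^ j := by
  have := Finset.single_le_sum (f := fun j => (n.choose j : ℝ) * x ^ j)
    (fun j _ => by positivity) (Finset.mem_Icc.2 ⟨h, le_rfl⟩)
  simpa using this

/-- This is the configuration in which every node is wrong and stays wrong. All entropies vanish
there, and the top monomials `x ^ c` of `F0` and `x ^ d` of `G0` keep the remaining infima
nonnegative. -/
lemma psi_one_nonneg (hT : ThresholdCondition c t c₁) (htd : t < d) :
    0 ≤ psi c d t c₁ 1 1 0 1 1 := by
  rw [le_psi_iff]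
  intro x₁ h₁ x₂ h₂ x₃ h₃ x₄ h₄
  rw [← EReal.coe_zero, EReal.coe_le_coe_iff]
  have hcc := hT.lt
  have hc₁ := hT.1
  have e1 : c * Real.log x₁ ≤ Real.log (F0 c c₁ x₁) := by
    rw [← Real.log_pow]
    exact Real.log_le_log (by positivity) (pow_le_sum_Icc c _ (by omega) h₁.le)
  have e2 : d * Real.log x₃ ≤ Real.log (G0 d t x₃) := by
    rw [← Real.log_pow]
    exact Real.log_le_log (by positivity) (pow_le_sum_Icc d _ (by omega) h₃.le)
  have hd : (0 : ℝ) < d := by exact_mod_cast (by omega : 0 < d)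
  have e3 : c * Real.log x₃ ≤ c / d * Real.log (G0 d t x₃) := by
    calc c * Real.log x₃ = c / d * (d * Real.log x₃) := by field_simp
      _ ≤ _ := by gcongr
  simp [psiAt, rhoAt, entropyPart, entropy, Fin.sum_univ_three]
  linarith

lemma Feasible.smul {α γ δ φ ω s : ℝ} (h : Feasible c d t c₁ α γ δ φ ω) (hs : 0 ≤ s)
    (hs1 : s ≤ 1) : Feasible c d t c₁ (s * α) (s * γ) (s * δ) (s * φ) (s * ω) where
  bad := by nlinarith [h.bad]
  gamma_nonneg := mul_nonneg hs h.gamma_nonneg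
  gamma_le := mul_le_mul_of_nonneg_left h.gamma_le hs
  delta_nonneg := mul_nonneg hs h.delta_nonneg
  delta_le := by nlinarith [h.delta_le]
  omega_nonneg := by nlinarith [h.omega_nonneg]
  omega_le := by
    rw [← mul_min_of_nonneg _ _ hs, mul_assoc, mul_assoc]
    exact mul_le_mul_of_nonneg_left h.omega_le hs
  edges_le := by
    have := mul_le_mul_of_nonneg_left h.edges_le hs
    nlinarith [mul_nonneg (sub_nonneg.2 hs1) (Nat.cast_nonneg c : (0 : ℝ) ≤ c)]
  phi_le := (mul_le_mul_of_nonneg_left h.phi_le hs).trans_eq (by ring)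
  delta_le' := (mul_le_mul_of_nonneg_left h.delta_le' hs).trans_eq (by ring)
  gamma_le' := (mul_le_mul_of_nonneg_left h.gamma_le' hs).trans_eq (by ring)

/-- `rhoAt` is affine in the parameters, with constant term `log F3 + (c / d) log G1 ≥ 0`. -/
lemma rhoAt_smul_ge {α γ δ φ ω s x₁ x₂ x₃ x₄ : ℝ} (hs1 : s ≤ 1) (h₂ : 0 ≤ x₂) (h₄ : 0 ≤ x₄) :
    s * rhoAt c d t c₁ α γ δ φ ω x₁ x₂ x₃ x₄ ≤
      rhoAt c d t c₁ (s * α) (s * γ) (s * δ) (s * φ) (s * ω) x₁ x₂ x₃ x₄ := by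
  have e1 := Real.log_nonneg (one_le_F3 c c₁ h₂)
  have e2 := Real.log_nonneg (one_le_G1 d t h₄)
  have e3 : 0 ≤ (1 - s) * (Real.log (F3 c c₁ x₂) + c / d * Real.log (G1 d t x₄)) :=
    mul_nonneg (by linarith) (by positivity)
  have e4 : rhoAt c d t c₁ (s * α) (s * γ) (s * δ) (s * φ) (s * ω) x₁ x₂ x₃ x₄
      = s * rhoAt c d t c₁ α γ δ φ ω x₁ x₂ x₃ x₄
        + (1 - s) * (Real.log (F3 c c₁ x₂) + c / d * Real.log (G1 d t x₄)) := by
    unfold rhoAt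
    ring
  linarith

/-- Positivity of `f` propagates to slightly smaller arguments. -/
lemma exists_psi_pos_of_f_pos {α : ℝ} (h : 0 < f c d t c₁ α) :
    ∃ s, 0 < s ∧ s < 1 ∧ ∃ γ δ φ ω, Feasible c d t c₁ (s * α) γ δ φ ω ∧
      0 ≤ psi c d t c₁ (s * α) γ δ φ ω := by
  obtain ⟨_, ⟨γ, δ, φ, ω, hF, rfl⟩, hpos⟩ := lt_sSup_iff.1 h
  obtain ⟨r, hr0, hr⟩ := EReal.lt_iff_exists_real_btwn.1 hpos
  have hr0 : 0 < r := by exact_mod_cast hr0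
  -- A lower bound for `psiAt` at the scaled parameters that is uniform in `x₁, …, x₄`. At `s = 1`
  -- it equals `r > 0`, so it stays positive for some `s < 1`.
  have hcont : Continuous fun s : ℝ => entropyPart c d (s * α) (s * γ) (s * δ) (s * φ) (s * ω)
      + s * (r - entropyPart c d α γ δ φ ω) := by
    simp only [entropyPart, entropy, Fin.sum_univ_three, Fin.sum_univ_one,
      Matrix.cons_val_zero, Matrix.cons_val_one, Matrix.cons_val, Matrix.cons_val_fin_one]
    fun_prop
  have hev : ∀ᶠ s in 𝓝 (1 : ℝ), 0 < entropyPart c d (s * α) (s * γ) (s * δ) (s * φ) (s * ω)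
      + s * (r - entropyPart c d α γ δ φ ω) := by
    refine hcont.continuousAt.eventually (lt_mem_nhds ?_)
    simpa using hr0
  have hev' : ∀ᶠ s in 𝓝[<] (1 : ℝ), 0 < s ∧ s < 1 ∧
      0 < entropyPart c d (s * α) (s * γ) (s * δ) (s * φ) (s * ω)
        + s * (r - entropyPart c d α γ δ φ ω) := by
    filter_upwards [hev.filter_mono nhdsWithin_le_nhds, self_mem_nhdsWithin,
      (lt_mem_nhds (zero_lt_one (α := ℝ))).filter_mono nhdsWithin_le_nhds] with s h1 h2 h3
    exact ⟨h3, h2, h1⟩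
  obtain ⟨s, hs0, hs1, hs⟩ := hev'.exists
  refine ⟨s, hs0, hs1, s * γ, s * δ, s * φ, s * ω, hF.smul hs0.le hs1.le, ?_⟩
  rw [le_psi_iff]
  intro x₁ h₁ x₂ h₂ x₃ h₃ x₄ h₄
  have h1 := le_psi_iff.1 hr.le x₁ h₁ x₂ h₂ x₃ h₃ x₄ h₄
  rw [EReal.coe_le_coe_iff] at h1
  rw [← EReal.coe_zero, EReal.coe_le_coe_iff]
  have h2 := rhoAt_smul_ge (c := c) (d := d) (t := t) (c₁ := c₁) (α := α) (γ := γ) (δ := δ) (φ := φ)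
    (ω := ω) (x₁ := x₁) (x₃ := x₃) hs1.le h₂.le h₄.le
  unfold psiAt at h1 ⊢
  have h3 : s * (r - entropyPart c d α γ δ φ ω) ≤ s * rhoAt c d t c₁ α γ δ φ ω x₁ x₂ x₃ x₄ :=
    mul_le_mul_of_nonneg_left (by linarith) hs0.le
  linarith

/-- The function `f` has a smallest positive root, and it is negative before that root. -/
lemma exists_isLeast_root (hT : ThresholdCondition c t c₁) (ht : 0 < t) (htd : t < d) :
    ∃ α₀ : ℝ, IsLeast {α : ℝ | 0 < α ∧ f c d t c₁ α = 0} α₀ ∧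
      ∀ α, 0 < α → α < α₀ → ∀ γ δ φ ω, Feasible c d t c₁ α γ δ φ ω →
        psi c d t c₁ α γ δ φ ω < 0 := by
  obtain ⟨ε, hε, hsmall⟩ := exists_forall_f_le_neg_mul (d := d) hT ht (by omega) 1
  set S := {α : ℝ | ε / 2 ≤ α ∧ α ≤ max 1 ε ∧ ∃ γ δ φ ω, Feasible c d t c₁ α γ δ φ ω ∧
      0 ≤ psi c d t c₁ α γ δ φ ω} with hS
  have hneg : ∀ α, 0 < α → α < ε → f c d t c₁ α < 0 := fun α h0 h1 =>
    (hsmall α h0 h1).trans_lt (EReal.coe_lt_coe_iff.2 (by linarith : -1 * α < 0))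
  have hε1 : ε ≤ 1 := by
    by_contra! hlt
    exact absurd ((psi_one_nonneg hT htd).trans (psi_le_f (feasible_one hT htd)))
      (not_le.2 (hneg 1 one_pos hlt))
  have hne : S.Nonempty := ⟨1, by linarith, le_max_left _ _, 1, 0, 1, 1, feasible_one hT htd,
    psi_one_nonneg hT htd⟩
  obtain ⟨α₀, hα₀, hmin⟩ := (isCompact_nonneg_f hT (ε / 2) (max 1 ε)).exists_isLeast hne
  have hpos : 0 < α₀ := by linarith [hα₀.1]
  have hbelow : ∀ α, 0 < α → α < α₀ → ∀ γ δ φ ω, Feasible c d t c₁ α γ δ φ ω →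
      psi c d t c₁ α γ δ φ ω < 0 := by
    intro α h0 h1 γ δ φ ω hF
    by_contra! hcon
    have h2 : ε ≤ α := by
      by_contra! hlt
      exact absurd (hcon.trans (psi_le_f hF)) (not_le.2 (hneg α h0 hlt))
    exact absurd (hmin (show α ∈ S from ⟨by linarith, h1.le.trans hα₀.2.1, γ, δ, φ, ω, hF, hcon⟩))
      (not_le.2 h1)
  refine ⟨α₀, ⟨⟨hpos, le_antisymm ?_ ?_⟩, ?_⟩, hbelow⟩
  · by_contra! hcon
    obtain ⟨s, hs0, hs1, γ, δ, φ, ω, hF, hp⟩ := exists_psi_pos_of_f_pos hcon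
    exact absurd hp (not_le.2 (hbelow (s * α₀) (by positivity) (by nlinarith) γ δ φ ω hF))
  · obtain ⟨-, -, γ, δ, φ, ω, hF, hp⟩ := hα₀
    exact hp.trans (psi_le_f hF)
  · rintro α ⟨h0, h1⟩
    by_contra! hlt
    have h2 : ε ≤ α := by
      by_contra! hlt'
      exact absurd h1 (hneg α h0 hlt').ne
    obtain ⟨η, hη, hf⟩ := exists_forall_f_le hT (a := α) (b := α)
      (fun β ha hb => hbelow β (by linarith) (by linarith))
    have := hf α le_rfl le_rfl
    rw [h1] at this
    have : (0 : ℝ) ≤ -η := by exact_mod_cast this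
    linarith

/-- Before its smallest positive root, `f` lies below a line of negative slope. -/
lemma exists_forall_f_le_mul (hT : ThresholdCondition c t c₁) (ht : 0 < t) (hd : 0 < d)
    {α' : ℝ} (h : ∀ α, 0 < α → α ≤ α' → ∀ γ δ φ ω, Feasible c d t c₁ α γ δ φ ω →
      psi c d t c₁ α γ δ φ ω < 0) :
    ∃ η > 0, ∀ α, 0 < α → α ≤ α' → f c d t c₁ α ≤ ((-η * α : ℝ) : EReal) := by
  obtain ⟨ε, hε, hsmall⟩ := exists_forall_f_le_neg_mul (d := d) hT ht hd 1
  obtain ⟨η, hη, hf⟩ := exists_forall_f_le hT (a := ε) (b := α')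
    (fun β ha hb => h β (by linarith) (by linarith))
  -- Slope `1` serves near `0`; beyond `ε` the constant gap `η` is turned into a slope, the maximum
  -- keeping the denominator positive for every `α'`.
  refine ⟨min 1 (η / max α' 1), by positivity, fun α h0 h1 => ?_⟩
  rcases lt_or_ge α ε with hlt | hge
  · refine (hsmall α h0 hlt).trans ?_
    rw [EReal.coe_le_coe_iff]
    have := min_le_left 1 (η / max α' 1)
    nlinarith
  · refine (hf α hge h1).trans ?_
    rw [EReal.coe_le_coe_iff]
    have h2 : min 1 (η / max α' 1) * α ≤ η / max α' 1 * max α' 1 :=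
      mul_le_mul (min_le_right _ _) (h1.trans (le_max_left _ _)) h0.le (by positivity)
    rw [div_mul_cancel₀ _ (by positivity)] at h2
    linarith

end

noncomputable section

/-! ### Counting tools -/

section Counting

open Finset

/-- Chernoff bound for the number of configurations `ι → σ` with prescribed numbers of labels and
prescribed weight. -/
lemma card_mul_prod_pow_le {ι σ Λ : Type*} [Fintype ι] [DecidableEq ι] [Fintype σ] [Fintype Λ]
    [DecidableEq Λ] (l : σ → Λ) (wt : σ → ℝ) (hwt : ∀ s, 0 ≤ wt s) (k : Λ → ℕ)
    (hk : ∑ a, k a = Fintype.card ι) (Z : Λ → ℝ) (hZ : ∀ a, 0 < Z a)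
    (hZsum : ∀ a, ∑ s, (if l s = a then wt s else 0) = Z a)
    (X : ℝ) (U : Finset (ι → σ)) (hU : ∀ u ∈ U, ∀ a, #{i | l (u i) = a} = k a)
    (hX : ∀ u ∈ U, ∏ i, wt (u i) = X) :
    (#U : ℝ) * X * ∏ a, (k a : ℝ) ^ k a ≤
      (Fintype.card ι : ℝ) ^ Fintype.card ι * ∏ a, Z a ^ k a := by
  -- Tilting: the total mass of `q` is the number of coordinates `n`, so summing the product of `q`
  -- over all configurations gives `n ^ n`. On `U` this product has the constant value `X * ∏ (k /
  -- Z) ^ k`.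
  set q : σ → ℝ := fun s => (k (l s) : ℝ) / Z (l s) * wt s with hq
  have hq0 : ∀ s, 0 ≤ q s := fun s => mul_nonneg (div_nonneg (by positivity) (hZ _).le) (hwt s)
  have hsum : ∑ s, q s = Fintype.card ι := by
    calc ∑ s, q s = ∑ s, ∑ a, (if l s = a then (k a : ℝ) / Z a * wt s else 0) := by
          refine sum_congr rfl fun s _ => ?_
          simp [hq]
      _ = ∑ a, (k a : ℝ) / Z a * Z a := by
          rw [sum_comm]
          refine sum_congr rfl fun a _ => ?_
          rw [← hZsum a, mul_sum]
          exact sum_congr rfl fun s _ => by rw [mul_ite, mul_zero]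
      _ = ∑ a, (k a : ℝ) := sum_congr rfl fun a _ => div_mul_cancel₀ _ (hZ a).ne'
      _ = Fintype.card ι := by rw [← hk]; push_cast; rfl
  have hprod : ∀ u ∈ U, ∏ i, q (u i) = X * ∏ a, ((k a : ℝ) / Z a) ^ k a := by
    intro u hu
    rw [prod_mul_distrib, hX u hu, mul_comm]
    congr 1
    rw [← prod_fiberwise univ (fun i => l (u i))]
    refine prod_congr rfl fun a _ => ?_
    rw [prod_congr rfl (g := fun _ => (k a : ℝ) / Z a), prod_const, hU u hu a]
    intro i hi
    rw [(mem_filter.1 hi).2]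
  have hmain : (#U : ℝ) * (X * ∏ a, ((k a : ℝ) / Z a) ^ k a) ≤
      (Fintype.card ι : ℝ) ^ Fintype.card ι := by
    calc (#U : ℝ) * (X * ∏ a, ((k a : ℝ) / Z a) ^ k a) = ∑ u ∈ U, ∏ i, q (u i) := by
          rw [sum_congr rfl hprod, sum_const, nsmul_eq_mul]
      _ ≤ ∑ u : ι → σ, ∏ i, q (u i) :=
          sum_le_sum_of_subset_of_nonneg (subset_univ _) fun _ _ _ => prod_nonneg fun _ _ => hq0 _
      _ = ∏ _i : ι, ∑ s, q s := by
          rw [prod_univ_sum, Fintype.piFinset_univ]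
      _ = _ := by rw [prod_const, hsum, card_univ]
  have hZpos : 0 < ∏ a, Z a ^ k a := prod_pos fun a _ => pow_pos (hZ a) _
  simp only [div_pow, prod_div_distrib] at hmain
  rw [← mul_assoc, ← mul_div_assoc, div_le_iff₀ hZpos] at hmain
  exact hmain

/-- Composing with the inverse of one colour-preserving bijection turns the others into permutations
that stabilise `p`. -/
lemma card_color_preserving_equiv_le {V C κ : Type*} [Fintype V] [DecidableEq V] [Fintype C]
    [DecidableEq C] [Fintype κ] [DecidableEq κ] (p : V → κ) (q : C → κ) :
    #{e : V ≃ C | ∀ v, q (e v) = p v} ≤ ∏ a, (#{v | p v = a}).factorial := by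
  rcases ({e : V ≃ C | ∀ v, q (e v) = p v} : Finset (V ≃ C)).eq_empty_or_nonempty with h | ⟨e₀, h₀⟩
  · simp [h]
  · have h₀ := (mem_filter.1 h₀).2
    have h1 : #{e : V ≃ C | ∀ v, q (e v) = p v} ≤ #{g : Equiv.Perm V | p ∘ g = p} := by
      refine card_le_card_of_injOn (fun e => e.trans e₀.symm) ?_ ?_
      · intro e he
        have he := (mem_filter.1 he).2
        refine mem_filter.2 ⟨mem_univ _, funext fun v => ?_⟩
        simp only [Function.comp_apply, Equiv.trans_apply]
        rw [← h₀, Equiv.apply_symm_apply, he]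
      · intro e _ e' _ hee
        ext v
        have := congrArg (fun g : V ≃ V => e₀ (g v)) hee
        simpa using this
    refine h1.trans_eq ?_
    have := DomMulAct.stabilizer_card p
    rw [Fintype.card_subtype] at this
    rw [this]
    exact prod_congr rfl fun a _ => by rw [Fintype.card_subtype]

lemma sum_powerset_card_ite (n : ℕ) (P : ℕ → Prop) [DecidablePred P] (x : ℝ) :
    ∑ T : Finset (Fin n), (if P #T then x ^ #T else 0) =
      ∑ j ∈ (range (n + 1)).filter P, (n.choose j : ℝ) * x ^ j := by
  have := sum_powerset_apply_card (fun j => if P j then x ^ j else (0 : ℝ))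
    (x := (univ : Finset (Fin n)))
  rw [powerset_univ] at this
  rw [this, card_univ, Fintype.card_fin, sum_filter]
  refine sum_congr rfl fun j _ => ?_
  split_ifs <;> simp

end Counting

/-! ### Factorials -/

lemma factorial_le_stirling {n : ℕ} (hn : 1 ≤ n) :
    (n.factorial : ℝ) ≤ Real.exp 1 * Real.sqrt n * (n / Real.exp 1) ^ n := by
  obtain ⟨m, rfl⟩ : ∃ m, n = m + 1 := ⟨n - 1, by omega⟩
  have h := Stirling.stirlingSeq'_antitone (Nat.zero_le m)
  simp only [Function.comp_apply, Nat.succ_eq_add_one, zero_add, Stirling.stirlingSeq_one] at h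
  rw [Stirling.stirlingSeq, div_le_iff₀ (by positivity)] at h
  refine h.trans_eq ?_
  rw [Real.sqrt_mul (by norm_num)]
  field_simp

lemma factorial_le_mul_pow (n : ℕ) :
    (n.factorial : ℝ) ≤ Real.exp 1 * (n + 1) * (n / Real.exp 1) ^ n := by
  rcases Nat.eq_zero_or_pos n with rfl | hn
  · simp
  · refine (factorial_le_stirling hn).trans ?_
    gcongr
    rw [Real.sqrt_le_left (by positivity)]
    have : (0 : ℝ) ≤ n := by positivity
    nlinarith

lemma factorial_le_sqrt_mul {n m : ℕ} (hnm : n ≤ m) (hm : 1 ≤ m) :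
    (n.factorial : ℝ) ≤ Real.exp 1 * Real.sqrt m * (n / Real.exp 1) ^ n := by
  rcases Nat.eq_zero_or_pos n with rfl | hn
  · have h1 : (1 : ℝ) ≤ Real.exp 1 := Real.one_le_exp zero_le_one
    have h2 : (1 : ℝ) ≤ Real.sqrt m := Real.one_le_sqrt.2 (by exact_mod_cast hm)
    simpa using one_le_mul_of_one_le_of_one_le h1 h2
  · refine (factorial_le_stirling hn).trans ?_
    gcongr

lemma sqrt_mul_pow_le_factorial (n : ℕ) :
    Real.sqrt n * (n / Real.exp 1) ^ n ≤ n.factorial := by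
  refine le_trans ?_ (Stirling.le_factorial_stirling n)
  gcongr
  have := Real.pi_gt_three
  have : (0 : ℝ) ≤ n := by positivity
  nlinarith

/-- The inverse of a multinomial coefficient, up to a factor that does not depend on the
last part. -/
lemma factorial_mul_le {k₁ k₂ k₃ k₀ n : ℕ} (hn : 1 ≤ n) (hsum : k₁ + k₂ + k₃ + k₀ = n) :
    ((k₁.factorial * k₂.factorial * k₃.factorial * k₀.factorial : ℕ) : ℝ) * (n : ℝ) ^ n ≤
      Real.exp 4 * ((k₁ + 1) * (k₂ + 1) * (k₃ + 1)) *
        ((k₁ : ℝ) ^ k₁ * (k₂ : ℝ) ^ k₂ * (k₃ : ℝ) ^ k₃ * (k₀ : ℝ) ^ k₀) * n.factorial := by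
  have h1 := factorial_le_mul_pow k₁
  have h2 := factorial_le_mul_pow k₂
  have h3 := factorial_le_mul_pow k₃
  -- Only the last part is estimated with `√n`, which cancels against the `√n` in the lower bound
  -- for `n!`; the other parts pay a linear factor.
  have h0 := factorial_le_sqrt_mul (n := k₀) (m := n) (by omega) hn
  have hN := sqrt_mul_pow_le_factorial n
  push_cast
  have hexp : Real.exp 1 ^ k₁ * Real.exp 1 ^ k₂ * Real.exp 1 ^ k₃ * Real.exp 1 ^ k₀
      = Real.exp 1 ^ n := by rw [← hsum]; ring
  have he4 : Real.exp 4 = Real.exp 1 ^ 4 := by rw [← Real.exp_nat_mul]; norm_num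
  calc _ ≤ (Real.exp 1 * (k₁ + 1) * (k₁ / Real.exp 1) ^ k₁) *
          (Real.exp 1 * (k₂ + 1) * (k₂ / Real.exp 1) ^ k₂) *
          (Real.exp 1 * (k₃ + 1) * (k₃ / Real.exp 1) ^ k₃) *
          (Real.exp 1 * Real.sqrt n * (k₀ / Real.exp 1) ^ k₀) * (n : ℝ) ^ n := by gcongr
    _ = Real.exp 4 * ((k₁ + 1) * (k₂ + 1) * (k₃ + 1)) *
        ((k₁ : ℝ) ^ k₁ * (k₂ : ℝ) ^ k₂ * (k₃ : ℝ) ^ k₃ * (k₀ : ℝ) ^ k₀) *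
          (Real.sqrt n * (n / Real.exp 1) ^ n) := by
        rw [he4]
        simp only [div_pow]
        rw [← hexp]
        field_simp
    _ ≤ _ := by gcongr

end

noncomputable section

open Finset

variable {N J c d : ℕ}

/-! ### Error sets and the checks they overload -/

/-- The sockets of the check node `j` that are matched with an erroneous variable node. -/
def errorSockets (E : Ensemble N J c d) (A : Finset (Fin N)) (j : Fin J) : Finset (Fin d) :=
  {m | (E.symm (j, m)).1 ∈ A}

/-- The check nodes that read more than `t` errors. -/
def badChecks (E : Ensemble N J c d) (t : ℕ) (A : Finset (Fin N)) : Finset (Fin J) :=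
  {j | t < #(errorSockets E A j)}

/-- The sockets of the variable node `i` that are matched with a bad check node. -/
def badSockets (E : Ensemble N J c d) (t : ℕ) (A : Finset (Fin N)) (i : Fin N) : Finset (Fin c) :=
  {k | (E (i, k)).1 ∈ badChecks E t A}

/-- The erroneous variable nodes that may fail to be corrected. -/
def stuckNodes (E : Ensemble N J c d) (t c₁ : ℕ) (A : Finset (Fin N)) : Finset (Fin N) :=
  {i | i ∈ A ∧ c - c₁ + 1 ≤ #(badSockets E t A i)}

/-- The correct variable nodes that may be corrupted. -/
def spoiledNodes (E : Ensemble N J c d) (t c₁ : ℕ) (A : Finset (Fin N)) : Finset (Fin N) :=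
  {i | i ∉ A ∧ c₁ ≤ #(badSockets E t A i)}

lemma card_filter_fst_mem {α β : Type*} [Fintype α] [Fintype β] (P : α → Prop) [DecidablePred P]
    (Q : α × β → Prop) [DecidablePred Q] :
    #{v : α × β | P v.1 ∧ Q v} = ∑ i ∈ univ.filter P, #{k | Q (i, k)} := by
  simp only [card_filter, Fintype.sum_prod_type, sum_filter, ite_and]
  refine sum_congr rfl fun i _ => ?_
  split_ifs <;> simp

section EdgeCounts

variable (E : Ensemble N J c d) (t : ℕ) (A : Finset (Fin N))

/-- The edges, seen from the variable nodes, sorted by the status of their end points. -/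
def edgeClass (x y : Bool) : ℕ :=
  #{v : Fin N × Fin c | decide (v.1 ∈ A) = x ∧ decide ((E v).1 ∈ badChecks E t A) = y}

lemma edgeClass_eq_sum_badSockets (x : Bool) :
    edgeClass E t A x true = ∑ i with decide (i ∈ A) = x, #(badSockets E t A i) := by
  rw [edgeClass, card_filter_fst_mem (fun i => decide (i ∈ A) = x)]
  simp [badSockets]

lemma edgeClass_eq_sum_errorSockets (y : Bool) :
    edgeClass E t A true y =
      ∑ j with decide (j ∈ badChecks E t A) = y, #(errorSockets E A j) := by
  have h : edgeClass E t A true y =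
      #{z : Fin J × Fin d | decide (z.1 ∈ badChecks E t A) = y ∧ (E.symm z).1 ∈ A} := by
    refine card_equiv E fun v => ?_
    simp [and_comm]
  rw [h, card_filter_fst_mem (fun j => decide (j ∈ badChecks E t A) = y)]
  simp [errorSockets]

lemma edgeClass_add_edgeClass_left (x : Bool) :
    edgeClass E t A x true + edgeClass E t A x false = #{i | decide (i ∈ A) = x} * c := by
  have h : #{v : Fin N × Fin c | decide (v.1 ∈ A) = x ∧ True} = #{i | decide (i ∈ A) = x} * c := by
    rw [card_filter_fst_mem (fun i => decide (i ∈ A) = x)]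
    simp
  rw [← h, edgeClass, edgeClass, ← card_union_of_disjoint]
  · congr 1
    ext v
    simp only [mem_union, mem_filter, mem_univ, true_and, and_true, decide_eq_true_eq,
      decide_eq_false_iff_not]
    tauto
  · rw [disjoint_left]
    intro v h1 h2
    simp only [mem_filter, mem_univ, true_and] at h1 h2
    simp [h1.2] at h2

lemma edgeClass_add_edgeClass_right (y : Bool) :
    edgeClass E t A true y + edgeClass E t A false y =
      #{j | decide (j ∈ badChecks E t A) = y} * d := by
  have h : #{z : Fin J × Fin d | decide (z.1 ∈ badChecks E t A) = y ∧ True} =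
      #{j | decide (j ∈ badChecks E t A) = y} * d := by
    rw [card_filter_fst_mem (fun j => decide (j ∈ badChecks E t A) = y)]
    simp
  have h' : #{z : Fin J × Fin d | decide (z.1 ∈ badChecks E t A) = y ∧ True} =
      #{v : Fin N × Fin c | decide ((E v).1 ∈ badChecks E t A) = y} := by
    refine (card_equiv E fun v => ?_).symm
    simp
  rw [← h, h', edgeClass, edgeClass, ← card_union_of_disjoint]
  · congr 1
    ext v
    simp only [mem_union, mem_filter, mem_univ, true_and, decide_eq_true_eq,
      decide_eq_false_iff_not]
    tauto
  · rw [disjoint_left]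
    intro v h1 h2
    simp only [mem_filter, mem_univ, true_and] at h1 h2
    simp [h1.1] at h2

lemma card_badChecks_mul_le : #(badChecks E t A) * (t + 1) ≤ edgeClass E t A true true := by
  rw [edgeClass_eq_sum_errorSockets, ← smul_eq_mul]
  simp only [decide_eq_true_eq, filter_univ_mem]
  exact card_nsmul_le_sum _ _ _ fun j hj => (mem_filter.1 hj).2

lemma card_stuckNodes_mul_le (c₁ : ℕ) :
    #(stuckNodes E t c₁ A) * (c - c₁ + 1) ≤ edgeClass E t A true true := by
  rw [edgeClass_eq_sum_badSockets, ← smul_eq_mul]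
  refine (card_nsmul_le_sum _ (fun i => #(badSockets E t A i)) _
    fun i hi => (mem_filter.1 hi).2.2).trans ?_
  refine sum_le_sum_of_subset fun i hi => ?_
  simpa using (mem_filter.1 hi).2.1

lemma card_spoiledNodes_mul_le (c₁ : ℕ) :
    #(spoiledNodes E t c₁ A) * c₁ ≤ edgeClass E t A false true := by
  rw [edgeClass_eq_sum_badSockets, ← smul_eq_mul]
  refine (card_nsmul_le_sum _ (fun i => #(badSockets E t A i)) _
    fun i hi => (mem_filter.1 hi).2.2).trans ?_
  refine sum_le_sum_of_subset fun i hi => ?_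
  simpa using (mem_filter.1 hi).2.1

lemma card_stuckNodes_le (c₁ : ℕ) : #(stuckNodes E t c₁ A) ≤ #A :=
  card_le_card fun _ hi => (mem_filter.1 hi).2.1

lemma card_add_card_spoiledNodes_le (c₁ : ℕ) : #A + #(spoiledNodes E t c₁ A) ≤ N := by
  rw [← card_union_of_disjoint]
  · exact (card_le_univ _).trans_eq (Fintype.card_fin N)
  · rw [disjoint_left]
    intro i hi hi'
    exact (mem_filter.1 hi').2.1 hi

end EdgeCounts

/-! ### The number of matchings with an error set of given profile -/

/-- Matchings together with error sets for which the sizes entering the exponent are given. -/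
def profileSet (N J c d t c₁ a g b s w : ℕ) : Finset (Ensemble N J c d × Finset (Fin N)) :=
  {x | #x.2 = a ∧ #(stuckNodes x.1 t c₁ x.2) = g ∧ #(spoiledNodes x.1 t c₁ x.2) = b ∧
    #(badChecks x.1 t x.2) = s ∧ edgeClass x.1 t x.2 true true = w}

/-- The view of a matching and an error set from the variable nodes. -/
def variableView (t : ℕ) (x : Ensemble N J c d × Finset (Fin N)) : Fin N → Bool × Finset (Fin c) :=
  fun i => (decide (i ∈ x.2), badSockets x.1 t x.2 i)

/-- The view of a matching and an error set from the check nodes. -/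
def checkView (x : Ensemble N J c d × Finset (Fin N)) : Fin J → Finset (Fin d) :=
  fun j => errorSockets x.1 x.2 j

/-- The views determine the error set and colour each socket by two bits: whether its variable node
is erroneous and whether its check is bad. The matching must respect these colours, whose classes
have sizes `w`, `w₂`, `w₃`, `w₄`. -/
lemma card_profileSet_le_views {t c₁ a g b s w w₂ w₃ w₄ : ℕ}
    (h₂ : w + w₂ = a * c) (h₃ : w + w₃ = s * d) (h₄ : w + w₂ + w₃ + w₄ = N * c) :
    #(profileSet N J c d t c₁ a g b s w) ≤
      (w.factorial * w₂.factorial * w₃.factorial * w₄.factorial) *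
        (#((profileSet N J c d t c₁ a g b s w).image (variableView t)) *
          #((profileSet N J c d t c₁ a g b s w).image checkView)) := by
  set P := profileSet N J c d t c₁ a g b s w with hP
  have h1 : #P ≤ (w.factorial * w₂.factorial * w₃.factorial * w₄.factorial) *
      #(P.image fun x => (variableView t x, checkView x)) := by
    refine card_le_mul_card_image _ _ fun uy huy => ?_
    obtain ⟨x₀, hx₀, rfl⟩ := mem_image.1 huy
    set p : Fin N × Fin c → Bool × Bool := fun v =>
      ((variableView t x₀ v.1).1, decide (v.2 ∈ (variableView t x₀ v.1).2)) with hp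
    set q : Fin J × Fin d → Bool × Bool := fun z =>
      (decide (z.2 ∈ checkView x₀ z.1), decide (t < #(checkView x₀ z.1))) with hq
    have hinj : #{x ∈ P | (variableView t x, checkView x) = (variableView t x₀, checkView x₀)} ≤
        #{e : (Fin N × Fin c) ≃ (Fin J × Fin d) | ∀ v, q (e v) = p v} := by
      refine card_le_card_of_injOn Prod.fst ?_ ?_
      · rintro ⟨e, A⟩ hx
        obtain ⟨-, hx⟩ := mem_filter.1 hx
        obtain ⟨hx1, hx2⟩ := Prod.mk.inj hx
        refine mem_filter.2 ⟨mem_univ _, fun v => ?_⟩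
        simp only [hp, hq, ← hx1, ← hx2]
        simp [checkView, variableView, errorSockets, badSockets, badChecks]
      · rintro ⟨e, A⟩ hx ⟨e', A'⟩ hx' (rfl : e = e')
        obtain ⟨-, hx⟩ := mem_filter.1 hx
        obtain ⟨-, hx'⟩ := mem_filter.1 hx'
        have h := (Prod.mk.inj (hx.trans hx'.symm)).1
        congr 1
        ext i
        have := congrArg Prod.fst (congrFun h i)
        simpa [variableView] using this
    refine (hinj.trans (card_color_preserving_equiv_le p q)).trans_eq ?_
    have hcl : ∀ x y, #{v | p v = (x, y)} = edgeClass x₀.1 t x₀.2 x y := by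
      intro x y
      rw [edgeClass]
      congr 1
      ext v
      simp [hp, variableView, badSockets]
    obtain ⟨-, ha, -, -, hs, hw⟩ := mem_filter.1 hx₀
    have e1 := edgeClass_add_edgeClass_left x₀.1 t x₀.2 true
    have e2 := edgeClass_add_edgeClass_left x₀.1 t x₀.2 false
    have e3 := edgeClass_add_edgeClass_right x₀.1 t x₀.2 true
    have e4 : #{i | decide (i ∈ x₀.2) = true} + #{i | decide (i ∈ x₀.2) = false} = N := by
      have := card_filter_add_card_filter_not (s := (univ : Finset (Fin N))) (· ∈ x₀.2)
      simpa using this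
    simp only [decide_eq_true_eq, filter_univ_mem] at e1 e3 e4
    rw [ha] at e1 e4
    rw [hs] at e3
    rw [← e4, add_mul, ← e2] at h₄
    rw [Fintype.prod_prod_type, Fintype.prod_bool, Fintype.prod_bool, Fintype.prod_bool, hcl, hcl,
      hcl, hcl, hw, show edgeClass x₀.1 t x₀.2 true false = w₂ by omega,
      show edgeClass x₀.1 t x₀.2 false true = w₃ by omega,
      show edgeClass x₀.1 t x₀.2 false false = w₄ by omega, mul_assoc]
    ring
  refine h1.trans (Nat.mul_le_mul_left _ ?_)
  rw [← card_product]
  refine card_le_card fun uy huy => ?_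
  obtain ⟨x, hx, rfl⟩ := mem_image.1 huy
  exact mem_product.2 ⟨mem_image_of_mem _ hx, mem_image_of_mem _ hx⟩

/-- Tilting bound with a node labelled by whether it is erroneous and whether its bad sockets reach
the relevant threshold. Bad sockets are marked by `x₁` at erroneous nodes and by `x₂` at correct
ones, so the four label masses are `F0`, `F1`, `F2`, `F3`. -/
lemma card_image_variableView_le {t c₁ a g g' b b' s w w₃ : ℕ} (h₁ : 1 ≤ c₁) (hcc : c₁ ≤ c)
    (h₃ : w + w₃ = s * d) (hg : g + g' = a) (hb : a + b + b' = N) {x₁ x₂ : ℝ}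
    (hx₁ : 0 < x₁) (hx₂ : 0 < x₂) :
    (#((profileSet N J c d t c₁ a g b s w).image (variableView t)) : ℝ) * (x₁ ^ w * x₂ ^ w₃) *
        ((g : ℝ) ^ g * (g' : ℝ) ^ g' * ((b : ℝ) ^ b * (b' : ℝ) ^ b')) ≤
      (N : ℝ) ^ N * (F0 c c₁ x₁ ^ g * F1 c c₁ x₁ ^ g' * (F2 c c₁ x₂ ^ b * F3 c c₁ x₂ ^ b')) := by
  have key := card_mul_prod_pow_le (ι := Fin N) (σ := Bool × Finset (Fin c)) (Λ := Bool × Bool)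
    (fun y => (y.1, decide ((if y.1 then c - c₁ + 1 else c₁) ≤ #y.2)))
    (fun y => (if y.1 then x₁ else x₂) ^ #y.2)
    (fun y => by split_ifs <;> positivity)
    (fun z => if z.1 then (if z.2 then g else g') else (if z.2 then b else b'))
    (by simp [Fintype.sum_prod_type]; omega)
    (fun z => if z.1 then (if z.2 then F0 c c₁ x₁ else F1 c c₁ x₁)
      else (if z.2 then F2 c c₁ x₂ else F3 c c₁ x₂))
    ?_ ?_ (x₁ ^ w * x₂ ^ w₃)
    ((profileSet N J c d t c₁ a g b s w).image (variableView t)) ?_ ?_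
  · simpa [Fintype.prod_prod_type] using key
  · rintro ⟨_ | _, _ | _⟩
    · simpa using (one_pos.trans_le (one_le_F3 c c₁ hx₂.le))
    · simpa using F2_pos hcc hx₂
    · simpa using F1_pos hx₁
    · simpa using F0_pos h₁ hcc hx₁
  · rintro ⟨_ | _, _ | _⟩
    · simp only [Fintype.sum_prod_type, Fintype.sum_bool]
      simp only [Prod.mk.injEq, Bool.true_eq_false, false_and, if_false, true_and,
        sum_const_zero, zero_add, Bool.false_eq_true, decide_eq_false_iff_not]
      rw [sum_powerset_card_ite c (fun j => ¬ c₁ ≤ j), F3]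
      refine sum_congr ?_ fun _ _ => rfl
      ext j
      simp only [mem_filter, mem_range, mem_Icc]
      omega
    · simp only [Fintype.sum_prod_type, Fintype.sum_bool]
      simp only [Prod.mk.injEq, Bool.true_eq_false, false_and, if_false, true_and,
        sum_const_zero, zero_add, Bool.false_eq_true, decide_eq_true_eq, if_true]
      rw [sum_powerset_card_ite c (fun j => c₁ ≤ j), F2]
      refine sum_congr ?_ fun _ _ => rfl
      ext j
      simp only [mem_filter, mem_range, mem_Icc]
      omega
    · simp only [Fintype.sum_prod_type, Fintype.sum_bool]
      simp only [Prod.mk.injEq, Bool.false_eq_true, false_and, if_false, true_and, if_true,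
        sum_const_zero, add_zero, decide_eq_false_iff_not]
      rw [sum_powerset_card_ite c (fun j => ¬ c - c₁ + 1 ≤ j), F1]
      refine sum_congr ?_ fun _ _ => rfl
      ext j
      simp only [mem_filter, mem_range, mem_Icc]
      omega
    · simp only [Fintype.sum_prod_type, Fintype.sum_bool]
      simp only [Prod.mk.injEq, Bool.false_eq_true, false_and, if_false, true_and, if_true,
        sum_const_zero, add_zero, decide_eq_true_eq]
      rw [sum_powerset_card_ite c (fun j => c - c₁ + 1 ≤ j), F0]
      refine sum_congr ?_ fun _ _ => rfl
      ext j
      simp only [mem_filter, mem_range, mem_Icc]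
      omega
  · rintro u hu
    obtain ⟨⟨e, A⟩, hx, rfl⟩ := mem_image.1 hu
    obtain ⟨-, ha, hg1, hb1, -, -⟩ := mem_filter.1 hx
    simp only at ha hg1 hb1
    have e1 := card_filter_add_card_filter_not (s := A) (fun i => c - c₁ + 1 ≤ #(badSockets e t A i))
    have e2 := card_filter_add_card_filter_not (s := Aᶜ) (fun i => c₁ ≤ #(badSockets e t A i))
    have e3 : #(stuckNodes e t c₁ A) = #{i ∈ A | c - c₁ + 1 ≤ #(badSockets e t A i)} := by
      congr 1; ext i; simp [stuckNodes]
    have e4 : #(spoiledNodes e t c₁ A) = #{i ∈ Aᶜ | c₁ ≤ #(badSockets e t A i)} := by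
      congr 1; ext i; simp [spoiledNodes]
    rw [card_compl, Fintype.card_fin] at e2
    rintro ⟨_ | _, _ | _⟩
    · simp only [Bool.false_eq_true, if_false]
      rw [show b' = #{i ∈ Aᶜ | ¬ c₁ ≤ #(badSockets e t A i)} by omega]
      congr 1; ext i
      by_cases h : i ∈ A <;> simp [variableView, h]
    · simp only [Bool.false_eq_true, if_false, if_true]
      rw [← hb1, e4]
      congr 1; ext i
      by_cases h : i ∈ A <;> simp [variableView, h]
    · simp only [Bool.false_eq_true, if_false, if_true]
      rw [show g' = #{i ∈ A | ¬ c - c₁ + 1 ≤ #(badSockets e t A i)} by omega]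
      congr 1; ext i
      by_cases h : i ∈ A <;> simp [variableView, h]
    · simp only [if_true]
      rw [← hg1, e3]
      congr 1; ext i
      by_cases h : i ∈ A <;> simp [variableView, h]
  · rintro u hu
    obtain ⟨⟨e, A⟩, hx, rfl⟩ := mem_image.1 hu
    obtain ⟨-, -, -, -, hs, hw⟩ := mem_filter.1 hx
    simp only at hs hw
    have e1 := edgeClass_add_edgeClass_right e t A true
    simp only [decide_eq_true_eq, filter_univ_mem] at e1
    rw [hs, hw, ← h₃, add_left_cancel_iff] at e1
    rw [← prod_filter_mul_prod_filter_not univ (fun i => decide (i ∈ A) = true),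
      ← hw, ← e1, edgeClass_eq_sum_badSockets, edgeClass_eq_sum_badSockets, ← prod_pow_eq_pow_sum,
      ← prod_pow_eq_pow_sum]
    congr 1
    · refine prod_congr rfl fun i hi => ?_
      rw [variableView, if_pos (mem_filter.1 hi).2]
    · simp only [Bool.not_eq_true]
      refine prod_congr rfl fun i hi => ?_
      rw [variableView, if_neg (by simpa using (mem_filter.1 hi).2)]

/-- The same bound on the check side: erroneous sockets are marked by `x₃` at bad checks and by `x₄`
at good ones, with masses `G0` and `G1`. -/
lemma card_image_checkView_le {t c₁ a g b s s' w w₂ : ℕ} (htd : t < d)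
    (h₂ : w + w₂ = a * c) (hs : s + s' = J) {x₃ x₄ : ℝ} (hx₃ : 0 < x₃) (hx₄ : 0 < x₄) :
    (#((profileSet N J c d t c₁ a g b s w).image checkView) : ℝ) * (x₃ ^ w * x₄ ^ w₂) *
        ((s : ℝ) ^ s * (s' : ℝ) ^ s') ≤
      (J : ℝ) ^ J * (G0 d t x₃ ^ s * G1 d t x₄ ^ s') := by
  have key := card_mul_prod_pow_le (ι := Fin J) (σ := Finset (Fin d)) (Λ := Bool)
    (fun T => decide (t < #T))
    (fun T => (if t < #T then x₃ else x₄) ^ #T)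
    (fun y => by split_ifs <;> positivity)
    (fun z => if z then s else s')
    (by simp; omega)
    (fun z => if z then G0 d t x₃ else G1 d t x₄)
    ?_ ?_ (x₃ ^ w * x₄ ^ w₂)
    ((profileSet N J c d t c₁ a g b s w).image checkView) ?_ ?_
  · simpa using key
  · rintro (_ | _)
    · simpa using (one_pos.trans_le (one_le_G1 d t hx₄.le))
    · simpa using G0_pos htd hx₃
  · rintro (_ | _)
    · simp only [decide_eq_false_iff_not, Bool.false_eq_true, if_false]
      rw [sum_congr rfl (g := fun T : Finset (Fin d) => if ¬ t < #T then x₄ ^ #T else 0)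
        (fun T _ => by split_ifs <;> rfl),
        sum_powerset_card_ite d (fun j => ¬ t < j), G1]
      refine sum_congr ?_ fun _ _ => rfl
      ext j
      simp only [mem_filter, mem_range, mem_Icc]
      omega
    · simp only [decide_eq_true_eq, if_true]
      rw [sum_congr rfl (g := fun T : Finset (Fin d) => if t < #T then x₃ ^ #T else 0)
        (fun T _ => by split_ifs <;> rfl),
        sum_powerset_card_ite d (fun j => t < j), G0]
      refine sum_congr ?_ fun _ _ => rfl
      ext j
      simp only [mem_filter, mem_range, mem_Icc]
      omega
  · rintro u hu
    obtain ⟨⟨e, A⟩, hx, rfl⟩ := mem_image.1 hu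
    obtain ⟨-, -, -, -, hs1, -⟩ := mem_filter.1 hx
    simp only at hs1
    have e1 := card_filter_add_card_filter_not (s := (univ : Finset (Fin J)))
      (fun j => t < #(errorSockets e A j))
    have e2 : #(badChecks e t A) = #{j | t < #(errorSockets e A j)} := rfl
    rw [card_univ, Fintype.card_fin] at e1
    rintro (_ | _)
    · simp only [Bool.false_eq_true, if_false]
      rw [show s' = #{j | ¬ t < #(errorSockets e A j)} by omega]
      congr 1; ext j
      rw [mem_filter, mem_filter]
      exact and_congr_right fun _ => decide_eq_false_iff_not
    · simp only [if_true]
      rw [← hs1, e2]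
      congr 1; ext j
      rw [mem_filter, mem_filter]
      exact and_congr_right fun _ => decide_eq_true_iff
  · rintro u hu
    obtain ⟨⟨e, A⟩, hx, rfl⟩ := mem_image.1 hu
    obtain ⟨-, ha, -, -, -, hw⟩ := mem_filter.1 hx
    simp only at ha hw
    have e1 := edgeClass_add_edgeClass_left e t A true
    simp only [decide_eq_true_eq, filter_univ_mem] at e1
    rw [ha, hw, ← h₂, add_left_cancel_iff] at e1
    rw [← prod_filter_mul_prod_filter_not univ (fun j => decide (j ∈ badChecks e t A) = true),
      ← hw, ← e1, edgeClass_eq_sum_errorSockets, edgeClass_eq_sum_errorSockets,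
      ← prod_pow_eq_pow_sum, ← prod_pow_eq_pow_sum]
    congr 1
    · refine prod_congr rfl fun j hj => ?_
      have := (mem_filter.1 hj).2
      rw [decide_eq_true_eq] at this
      rw [checkView, if_pos (mem_filter.1 this).2]
    · simp only [Bool.not_eq_true]
      refine prod_congr rfl fun j hj => ?_
      have := (mem_filter.1 hj).2
      rw [decide_eq_false_iff_not] at this
      rw [checkView, if_neg (fun h => this (mem_filter.2 ⟨mem_univ _, h⟩))]

end

noncomputable section

open Finset

variable {N J c d : ℕ}

/-! ### Comparison of the counts with the exponent -/

lemma natCast_pow_self_eq_exp (k : ℕ) : (k : ℝ) ^ k = Real.exp (k * Real.log k) := by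
  rcases Nat.eq_zero_or_pos k with rfl | hk
  · simp
  · rw [Real.exp_nat_mul, Real.exp_log (by exact_mod_cast hk)]

lemma pow_eq_exp_mul_log {x : ℝ} (hx : 0 < x) (k : ℕ) : x ^ k = Real.exp (k * Real.log x) := by
  rw [Real.exp_nat_mul, Real.exp_log hx]

lemma mul_negMulLog_div {n : ℝ} (hn : 0 < n) (k : ℝ) :
    n * Real.negMulLog (k / n) = k * Real.log n - k * Real.log k := by
  rcases eq_or_ne k 0 with rfl | hk
  · simp
  · rw [Real.negMulLog, Real.log_div hk hn.ne']
    field_simp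
    ring

/-- Dictionary between counts and fractions. It is exact, with no Stirling error, and vanishing
counts are covered by `0 log 0 = 0`. -/
lemma mul_psiAt_div (t c₁ : ℕ) {a g g' b b' s s' w w₂ w₃ w₄ : ℕ} (hN : 0 < N) (hc : 0 < c)
    (hd : 0 < d) (hJ : N * c = J * d) (h₂ : w + w₂ = a * c) (h₃ : w + w₃ = s * d)
    (h₄ : w + w₂ + w₃ + w₄ = N * c) (hg : g + g' = a) (hb : a + b + b' = N) (hs : s + s' = J)
    (x₁ x₂ x₃ x₄ : ℝ) :
    N * psiAt c d t c₁ (a / N) (g / N) (b / N) (s / J) (w / (N * c)) x₁ x₂ x₃ x₄ =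
      (N * Real.log N - g * Real.log g - g' * Real.log g' - b * Real.log b - b' * Real.log b')
      + (J * Real.log J - s * Real.log s - s' * Real.log s')
      - ((N * c) * Real.log (N * c) - w * Real.log w - w₂ * Real.log w₂ - w₃ * Real.log w₃
          - w₄ * Real.log w₄)
      + (g * Real.log (F0 c c₁ x₁) + g' * Real.log (F1 c c₁ x₁) - w * Real.log x₁)
      + (b * Real.log (F2 c c₁ x₂) + b' * Real.log (F3 c c₁ x₂) - w₃ * Real.log x₂)
      + (s * Real.log (G0 d t x₃) - w * Real.log x₃)
      + (s' * Real.log (G1 d t x₄) - w₂ * Real.log x₄) := by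
  have hJ0 : 0 < J := by
    rcases Nat.eq_zero_or_pos J with rfl | h
    · have := Nat.mul_pos hN hc
      omega
    · exact h
  have hN' : (0 : ℝ) < N := by exact_mod_cast hN
  have hJ' : (0 : ℝ) < J := by exact_mod_cast hJ0
  have hc' : (0 : ℝ) < c := by exact_mod_cast hc
  have hd' : (0 : ℝ) < d := by exact_mod_cast hd
  have hn : (0 : ℝ) < N * c := by positivity
  have hJR : (N : ℝ) * c = J * d := by exact_mod_cast hJ
  have h₂R : (w : ℝ) + w₂ = a * c := by exact_mod_cast h₂
  have h₃R : (w : ℝ) + w₃ = s * d := by exact_mod_cast h₃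
  have h₄R : (w : ℝ) + w₂ + w₃ + w₄ = N * c := by exact_mod_cast h₄
  have hgR : (g : ℝ) + g' = a := by exact_mod_cast hg
  have hbR : (a : ℝ) + b + b' = N := by exact_mod_cast hb
  have hsR : (s : ℝ) + s' = J := by exact_mod_cast hs
  have hcd : (N : ℝ) * (c / d) = J := by field_simp; linarith
  have e1 : (a : ℝ) / N - g / N = g' / N := by rw [← hgR]; ring
  have e2 : 1 - ((g : ℝ) / N + g' / N + b / N) = b' / N := by
    field_simp; linarith
  have e3 : 1 - (s : ℝ) / J = s' / J := by field_simp; linarith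
  have e4 : (a : ℝ) / N - w / (N * c) = w₂ / (N * c) := by field_simp; linarith
  have e5 : (s : ℝ) / J - w / (N * c) = w₃ / (N * c) := by
    have : (s : ℝ) / J = s * d / (N * c) := by rw [hJR]; field_simp
    rw [this, ← h₃R]; ring
  have e6 : 1 - ((w : ℝ) / (N * c) + w₂ / (N * c) + w₃ / (N * c)) = w₄ / (N * c) := by
    field_simp; linarith
  have e7 : 1 - (a : ℝ) / N - b / N = b' / N := by field_simp; linarith
  have i1 := mul_negMulLog_div hN' g
  have i2 := mul_negMulLog_div hN' g'
  have i3 := mul_negMulLog_div hN' b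
  have i4 := mul_negMulLog_div hN' b'
  have i5 := mul_negMulLog_div hJ' s
  have i6 := mul_negMulLog_div hJ' s'
  have i7 := mul_negMulLog_div hn w
  have i8 := mul_negMulLog_div hn w₂
  have i9 := mul_negMulLog_div hn w₃
  have i10 := mul_negMulLog_div hn w₄
  have hent : (N : ℝ) * entropyPart c d (a / N) (g / N) (b / N) (s / J) (w / (N * c)) =
      (N * Real.log N - g * Real.log g - g' * Real.log g' - b * Real.log b - b' * Real.log b')
      + (J * Real.log J - s * Real.log s - s' * Real.log s')
      - ((N * c) * Real.log (N * c) - w * Real.log w - w₂ * Real.log w₂ - w₃ * Real.log w₃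
          - w₄ * Real.log w₄) := by
    simp only [entropyPart, entropy, Fin.sum_univ_three, Fin.sum_univ_one, Matrix.cons_val_zero,
      Matrix.cons_val_one, Matrix.cons_val, Matrix.cons_val_fin_one]
    rw [e1, e2, e3, e4, e5, e6]
    have j1 : (N : ℝ) * Real.log N = (g + g' + b + b') * Real.log N := by
      rw [hgR, hbR]
    have j2 : (J : ℝ) * Real.log J = (s + s') * Real.log J := by rw [hsR]
    have j3 : (N * c : ℝ) * Real.log (N * c) = (w + w₂ + w₃ + w₄) * Real.log (N * c) := by rw [h₄R]
    rw [j1, j2, j3]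
    have k1 : ∀ A B C : ℝ, (N : ℝ) * (A + (c : ℝ) / d * B - c * C) = N * A + J * B - N * c * C := by
      intro A B C
      rw [← hcd]; ring
    rw [k1]
    linear_combination i1 + i2 + i3 + i4 + i5 + i6 - i7 - i8 - i9 - i10
  have hrho : (N : ℝ) * rhoAt c d t c₁ (a / N) (g / N) (b / N) (s / J) (w / (N * c)) x₁ x₂ x₃ x₄ =
      (g * Real.log (F0 c c₁ x₁) + g' * Real.log (F1 c c₁ x₁) - w * Real.log x₁)
      + (b * Real.log (F2 c c₁ x₂) + b' * Real.log (F3 c c₁ x₂) - w₃ * Real.log x₂)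
      + (s * Real.log (G0 d t x₃) - w * Real.log x₃)
      + (s' * Real.log (G1 d t x₄) - w₂ * Real.log x₄) := by
    unfold rhoAt
    rw [e1, e3, e4, e5, e7]
    have k1 : (N : ℝ) * (s / J * c / d) = s := by
      field_simp; linear_combination (s : ℝ) * hJR
    have k2 : (N : ℝ) * (s' / J * c / d) = s' := by
      field_simp; linear_combination (s' : ℝ) * hJR
    have k3 : ∀ k : ℝ, (N : ℝ) * (k / (N * c) * c) = k := fun k => by field_simp
    have k4 : ∀ k : ℝ, (N : ℝ) * (k / N) = k := fun k => by field_simp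
    linear_combination Real.log (F0 c c₁ x₁) * k4 g + Real.log (F1 c c₁ x₁) * k4 g'
      - Real.log x₁ * k3 w + Real.log (F2 c c₁ x₂) * k4 b + Real.log (F3 c c₁ x₂) * k4 b'
      - Real.log x₂ * k3 w₃ + Real.log (G0 d t x₃) * k1 - Real.log x₃ * k3 w
      + Real.log (G1 d t x₄) * k2 - Real.log x₄ * k3 w₂
  rw [psiAt, mul_add, hent, hrho]
  ring

lemma card_profileSet_le {t c₁ a g g' b b' s s' w w₂ w₃ w₄ : ℕ} (hN : 0 < N) (h₁ : 1 ≤ c₁)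
    (hcc : c₁ ≤ c) (htd : t < d) (hJ : N * c = J * d) (h₂ : w + w₂ = a * c) (h₃ : w + w₃ = s * d)
    (h₄ : w + w₂ + w₃ + w₄ = N * c) (hg : g + g' = a) (hb : a + b + b' = N) (hs : s + s' = J)
    {x₁ x₂ x₃ x₄ : ℝ} (hx₁ : 0 < x₁) (hx₂ : 0 < x₂) (hx₃ : 0 < x₃) (hx₄ : 0 < x₄) :
    (#(profileSet N J c d t c₁ a g b s w) : ℝ) ≤
      Real.exp 4 * ((w + 1) * (w₂ + 1) * (w₃ + 1)) *
        Real.exp (N * psiAt c d t c₁ (a / N) (g / N) (b / N) (s / J) (w / (N * c)) x₁ x₂ x₃ x₄) *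
        (N * c).factorial := by
  have hc : 0 < c := by omega
  have hn : 1 ≤ N * c := Nat.mul_pos hN hc
  have hV := card_image_variableView_le (t := t) (g := g) (b := b) (N := N) (J := J) h₁ hcc h₃ hg hb
    hx₁ hx₂
  have hC := card_image_checkView_le (c₁ := c₁) (g := g) (b := b) (N := N) htd h₂ hs hx₃ hx₄
  have hM := card_profileSet_le_views (N := N) (J := J) (t := t) (c₁ := c₁) (g := g) (b := b)
    h₂ h₃ h₄
  have hS := factorial_mul_le hn h₄
  rw [mul_psiAt_div t c₁ hN hc (by omega) hJ h₂ h₃ h₄ hg hb hs]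
  generalize #((profileSet N J c d t c₁ a g b s w).image (variableView t)) = U at hV hM
  generalize #((profileSet N J c d t c₁ a g b s w).image checkView) = Y at hC hM
  generalize w.factorial * w₂.factorial * w₃.factorial * w₄.factorial = Q at hM hS
  have hM' : (#(profileSet N J c d t c₁ a g b s w) : ℝ) ≤ Q * (U * Y) := by exact_mod_cast hM
  refine hM'.trans ?_
  simp only [natCast_pow_self_eq_exp, pow_eq_exp_mul_log hx₁, pow_eq_exp_mul_log hx₂,
    pow_eq_exp_mul_log (F0_pos h₁ hcc hx₁), pow_eq_exp_mul_log (F1_pos (c := c) (c₁ := c₁) hx₁),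
    pow_eq_exp_mul_log (F2_pos hcc hx₂),
    pow_eq_exp_mul_log (one_pos.trans_le (one_le_F3 c c₁ hx₂.le)), ← Real.exp_add] at hV
  simp only [natCast_pow_self_eq_exp, pow_eq_exp_mul_log hx₃, pow_eq_exp_mul_log hx₄,
    pow_eq_exp_mul_log (G0_pos htd hx₃),
    pow_eq_exp_mul_log (one_pos.trans_le (one_le_G1 d t hx₄.le)), ← Real.exp_add] at hC
  simp only [natCast_pow_self_eq_exp, ← Real.exp_add] at hS
  rw [mul_assoc, ← Real.exp_add, ← le_div_iff₀ (Real.exp_pos _), ← Real.exp_sub] at hV hC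
  rw [← le_div_iff₀ (Real.exp_pos _)] at hS
  -- Isolates the multiplication of the three bounds, leaving only a linear identity between
  -- exponents.
  have combine : ∀ {C S n V W e q u y m : ℝ}, 0 ≤ q → 0 ≤ u → 0 ≤ y →
      q ≤ C * Real.exp S * m / Real.exp n → u ≤ Real.exp V → y ≤ Real.exp W →
      S - n + (V + W) = e → q * (u * y) ≤ C * Real.exp e * m := by
    rintro C S n V W e q u y m hq hu hy h1 h2 h3 rfl
    rw [Real.exp_add, Real.exp_sub, Real.exp_add]
    calc q * (u * y) ≤ C * Real.exp S * m / Real.exp n * (Real.exp V * Real.exp W) :=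
          mul_le_mul h1 (mul_le_mul h2 h3 hy (Real.exp_pos _).le) (mul_nonneg hu hy) (hq.trans h1)
      _ = _ := by ring
  refine combine (by positivity) (by positivity) (by positivity) hS hV hC ?_
  push_cast
  ring

/-- The constraints are double counts of edges and nodes, normalised; `hab`, the failure to shrink,
supplies the field `bad`. -/
lemma feasible_of_mem_profileSet {t c₁ a g b s w : ℕ} (hN : 0 < N) (h₁ : 1 ≤ c₁)
    (hcc : c₁ ≤ c) (hd : 0 < d) (hJ : N * c = J * d) (hab : a ≤ g + b)
    {x : Ensemble N J c d × Finset (Fin N)} (hx : x ∈ profileSet N J c d t c₁ a g b s w) :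
    Feasible c d t c₁ (a / N) (g / N) (b / N) (s / J) (w / (N * c)) := by
  obtain ⟨E, A⟩ := x
  obtain ⟨-, ha, hg, hb, hs, hw⟩ := mem_filter.1 hx
  simp only at ha hg hb hs hw
  have hc : 0 < c := by omega
  have hJ0 : 0 < J := by
    rcases Nat.eq_zero_or_pos J with rfl | h
    · have := Nat.mul_pos hN hc
      omega
    · exact h
  have hga := card_stuckNodes_le E t A c₁
  have hbN := card_add_card_spoiledNodes_le E t A c₁
  have h1 := edgeClass_add_edgeClass_left E t A true
  have h2 := edgeClass_add_edgeClass_right E t A true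
  have h3 := edgeClass_add_edgeClass_right E t A false
  have h4 := card_badChecks_mul_le E t A
  have h5 := card_stuckNodes_mul_le E t A c₁
  have h6 := card_spoiledNodes_mul_le E t A c₁
  have h7 := card_filter_add_card_filter_not (s := (univ : Finset (Fin J)))
    (fun j => decide (j ∈ badChecks E t A) = true)
  simp only [Bool.not_eq_true, card_univ, Fintype.card_fin] at h7
  simp only [decide_eq_true_eq, filter_univ_mem] at h1 h2 h7
  rw [ha, hw] at h1
  rw [hs, hw] at h2
  rw [hs] at h4 h7
  rw [hg] at h5 hga
  rw [ha] at hga hbN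
  rw [hb] at h6 hbN
  rw [hw] at h4 h5
  have hN' : (0 : ℝ) < N := by exact_mod_cast hN
  have hJ' : (0 : ℝ) < J := by exact_mod_cast hJ0
  have hc' : (0 : ℝ) < c := by exact_mod_cast hc
  have hd' : (0 : ℝ) < d := by exact_mod_cast hd
  have h₁' : (1 : ℝ) ≤ c₁ := by exact_mod_cast h₁
  have hcc' : (c₁ : ℝ) ≤ c := by exact_mod_cast hcc
  have hJR : (N : ℝ) * c = J * d := by exact_mod_cast hJ
  have hsJ : (s : ℝ) / J = s * d / (N * c) := by rw [hJR]; field_simp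
  have hn : (0 : ℝ) < N * c := by positivity
  have haN : (a : ℝ) / N = a * c / (N * c) := by field_simp
  constructor
  · rw [← sub_div]
    gcongr
    rw [sub_le_iff_le_add]
    exact_mod_cast (by omega : a ≤ b + g)
  · positivity
  · gcongr
  · positivity
  · rw [div_le_iff₀ hN', sub_mul, one_mul, div_mul_cancel₀ _ hN'.ne', le_sub_iff_add_le']
    exact_mod_cast hbN
  · positivity
  · gcongr
    refine le_min ?_ ?_
    · rw [haN]
      gcongr
      exact_mod_cast (by omega : w ≤ a * c)
    · rw [hsJ]
      gcongr
      exact_mod_cast (by omega : w ≤ s * d)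
  · refine mul_le_mul_of_nonneg_right ?_ hc'.le
    rw [haN, hsJ, ← sub_div, div_le_iff₀ hn, sub_mul, one_mul, div_mul_cancel₀ _ hn.ne']
    have hkey : a * c + s * d ≤ N * c + w := by
      rw [hJ, ← h7, add_mul, ← h3]
      omega
    have : (a : ℝ) * c + s * d ≤ N * c + w := by exact_mod_cast hkey
    linarith
  · have : (s : ℝ) * (t + 1) ≤ w := by exact_mod_cast h4
    rw [hsJ, le_div_iff₀ (by positivity)]
    calc (s : ℝ) * d / (N * c) * (t + 1) = s * (t + 1) * d / (N * c) := by ring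
      _ ≤ w * d / (N * c) := by gcongr
      _ = w / (N * c) * d := by ring
  · have h8 : (b : ℝ) * c₁ + w ≤ s * d := by exact_mod_cast (by omega : b * c₁ + w ≤ s * d)
    rw [hsJ, ← sub_div, le_div_iff₀ (by positivity)]
    calc (b : ℝ) / N * c₁ = b * c₁ / N := by ring
      _ ≤ (s * d - w) / N := by gcongr; linarith
      _ = _ := by field_simp
  · have h8 : (g : ℝ) * (c - c₁ + 1) ≤ w := by
      have : (g : ℝ) * ((c - c₁ + 1 : ℕ) : ℝ) ≤ w := by exact_mod_cast h5
      rwa [Nat.cast_add, Nat.cast_sub hcc, Nat.cast_one] at this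
    rw [le_div_iff₀ (by linarith)]
    calc (g : ℝ) / N * (c - c₁ + 1) = g * (c - c₁ + 1) / N := by ring
      _ ≤ w / N := by gcongr
      _ = _ := by field_simp

/-- The matchings for which some error set of size `a` may not shrink in one iteration. -/
def failSet (N J c d t c₁ a : ℕ) : Finset (Ensemble N J c d) :=
  {E | ∃ A : Finset (Fin N), #A = a ∧ a ≤ #(stuckNodes E t c₁ A) + #(spoiledNodes E t c₁ A)}

lemma card_profileSet_le_exp {t c₁ a g b s w : ℕ} (hN : 0 < N) (h₁ : 1 ≤ c₁)
    (hcc : c₁ ≤ c) (htd : t < d) (hJ : N * c = J * d) (hab : a ≤ g + b) {β : ℝ}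
    (hf : f c d t c₁ (a / N) ≤ ((-β * (a / N) : ℝ) : EReal)) :
    (#(profileSet N J c d t c₁ a g b s w) : ℝ) ≤
      Real.exp 5 * (((c * d : ℕ) : ℝ) * (a + 1)) ^ 3 * Real.exp (-β * a) * (N * c).factorial := by
  rcases (profileSet N J c d t c₁ a g b s w).eq_empty_or_nonempty with h | ⟨⟨E, A⟩, hx⟩
  · rw [h, card_empty, Nat.cast_zero]
    positivity
  have hF := feasible_of_mem_profileSet hN h₁ hcc (by omega) hJ hab hx
  have hN' : (0 : ℝ) < N := by exact_mod_cast hN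
  -- The infimum need not be attained, or even finite. A slack of `1 / N` suffices and costs a
  -- factor `e` in total, which turns `exp 4` into `exp 5`.
  obtain ⟨x₁, hx₁, x₂, hx₂, x₃, hx₃, x₄, hx₄, hlt⟩ :=
    exists_psiAt_lt (r := -β * (a / N) + 1 / N) (((psi_le_f hF).trans hf).trans_lt
      (EReal.coe_lt_coe_iff.2 (by linarith [one_div_pos.2 hN'])))
  obtain ⟨-, ha, hg, hb, hs, hw⟩ := mem_filter.1 hx
  simp only at ha hg hb hs hw
  have hga := card_stuckNodes_le E t A c₁
  have hbN := card_add_card_spoiledNodes_le E t A c₁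
  have h1 := edgeClass_add_edgeClass_left E t A true
  have h1' := edgeClass_add_edgeClass_left E t A false
  have h2 := edgeClass_add_edgeClass_right E t A true
  have h4 := card_badChecks_mul_le E t A
  have hsJ : #(badChecks E t A) ≤ J := (card_le_univ _).trans_eq (Fintype.card_fin J)
  have h7 := card_filter_add_card_filter_not (s := (univ : Finset (Fin N)))
    (fun i => decide (i ∈ A) = true)
  simp only [Bool.not_eq_true, card_univ, Fintype.card_fin] at h7
  simp only [decide_eq_true_eq, filter_univ_mem] at h1 h2 h7
  rw [ha, hw] at h1
  rw [hs, hw] at h2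
  rw [hs] at h4 hsJ
  rw [ha] at hga hbN h7
  rw [hg] at hga
  rw [hb] at hbN
  rw [hw] at h4
  have hsum : w + edgeClass E t A true false + edgeClass E t A false true
      + edgeClass E t A false false = N * c := by
    have := congrArg (· * c) h7
    simp only [add_mul] at this
    omega
  have key := card_profileSet_le (a := a) (g := g) (g' := a - g) (b := b) (b' := N - a - b) (s := s)
    (s' := J - s) hN h₁ hcc htd hJ h1 h2 hsum (by omega) (by omega) (by omega) hx₁ hx₂ hx₃ hx₄
  refine key.trans ?_
  set w₂ := edgeClass E t A true false
  set w₃ := edgeClass E t A false true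
  have hcd1 : c ≤ c * d := Nat.le_mul_of_pos_right c (by omega)
  have hcd0 : 1 ≤ c * d := Nat.mul_pos (by omega) (by omega)
  have hac : a * c + 1 ≤ c * d * (a + 1) := by nlinarith
  -- A bad check carries an erroneous edge, so `s ≤ w ≤ a * c`. Hence `w`, `w₂` and `w₃` are all
  -- `O(a)`, with constants independent of `N`.
  have hsw : s ≤ w := (Nat.le_mul_of_pos_right s (by omega)).trans h4
  have hw₃ : w₃ + 1 ≤ c * d * (a + 1) := by
    have : s * d ≤ a * c * d := Nat.mul_le_mul_right d (by omega)
    nlinarith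
  have b1 : (w : ℝ) + 1 ≤ ((c * d : ℕ) : ℝ) * (a + 1) := by
    exact_mod_cast (by omega : w + 1 ≤ c * d * (a + 1))
  have b2 : (w₂ : ℝ) + 1 ≤ ((c * d : ℕ) : ℝ) * (a + 1) := by
    exact_mod_cast (by omega : w₂ + 1 ≤ c * d * (a + 1))
  have b3 : (w₃ : ℝ) + 1 ≤ ((c * d : ℕ) : ℝ) * (a + 1) := by exact_mod_cast hw₃
  have b4 : (N : ℝ) * psiAt c d t c₁ (a / N) (g / N) (b / N) (s / J) (w / (N * c)) x₁ x₂ x₃ x₄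
      ≤ 1 + -β * a := by
    calc _ ≤ (N : ℝ) * (-β * (a / N) + 1 / N) := by gcongr
      _ = 1 + -β * a := by field_simp; ring
  calc _ ≤ Real.exp 4 * ((((c * d : ℕ) : ℝ) * (a + 1)) * (((c * d : ℕ) : ℝ) * (a + 1)) *
        (((c * d : ℕ) : ℝ) * (a + 1))) * Real.exp (1 + -β * a) * (N * c).factorial := by gcongr
    _ = _ := by
      rw [Real.exp_add, show (5 : ℝ) = 4 + 1 by norm_num, Real.exp_add 4 1]
      ring

lemma card_failSet_le {t c₁ a : ℕ} (hN : 0 < N) (h₁ : 1 ≤ c₁)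
    (hcc : c₁ ≤ c) (htd : t < d) (hJ : N * c = J * d) {β : ℝ}
    (hf : f c d t c₁ (a / N) ≤ ((-β * (a / N) : ℝ) : EReal)) :
    (#(failSet N J c d t c₁ a) : ℝ) ≤
      Real.exp 5 * (((c * d : ℕ) : ℝ) * (a + 1)) ^ 7 * Real.exp (-β * a) * (N * c).factorial := by
  classical
  -- All four profile parameters lie in this range. The fourth power from counting profiles and the
  -- cube from each profile make the exponent `7`.
  set R := range (c * d * (a + 1)) with hR
  set T := (R ×ˢ R ×ˢ R ×ˢ R).filter fun p : ℕ × ℕ × ℕ × ℕ => a ≤ p.1 + p.2.1 with hT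
  have hsub : failSet N J c d t c₁ a ⊆ T.biUnion fun p =>
      (profileSet N J c d t c₁ a p.1 p.2.1 p.2.2.1 p.2.2.2).image Prod.fst := by
    intro E hE
    obtain ⟨-, A, ha, hle⟩ := mem_filter.1 hE
    have hga := card_stuckNodes_le E t A c₁
    have h1 := edgeClass_add_edgeClass_left E t A true
    have h2 := edgeClass_add_edgeClass_right E t A true
    have h4 := card_badChecks_mul_le E t A
    have h6 := card_spoiledNodes_mul_le E t A c₁
    simp only [decide_eq_true_eq, filter_univ_mem] at h1 h2
    have hsw := (Nat.le_mul_of_pos_right (#(badChecks E t A)) (by omega : 0 < t + 1)).trans h4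
    have hbw := (Nat.le_mul_of_pos_right (#(spoiledNodes E t c₁ A)) h₁).trans h6
    have hcd1 : c ≤ c * d := Nat.le_mul_of_pos_right c (by omega)
    have hcd0 : 1 ≤ c * d := Nat.mul_pos (by omega) (by omega)
    have hac : a * c + 1 ≤ c * d * (a + 1) := by nlinarith
    have ha1 : a + 1 ≤ c * d * (a + 1) := Nat.le_mul_of_pos_left _ hcd0
    rw [ha] at hga h1
    have hw₃ : edgeClass E t A false true + 1 ≤ c * d * (a + 1) := by
      have : #(badChecks E t A) * d ≤ a * c * d := Nat.mul_le_mul_right d (by omega)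
      nlinarith
    refine mem_biUnion.2 ⟨(#(stuckNodes E t c₁ A), #(spoiledNodes E t c₁ A), #(badChecks E t A),
      edgeClass E t A true true), ?_, mem_image.2 ⟨(E, A), ?_, rfl⟩⟩
    · simp only [hT, hR, mem_filter, mem_product, mem_range]
      exact ⟨⟨by omega, by omega, by omega, by omega⟩, hle⟩
    · simp [profileSet, ha]
  have hcard : (#T : ℝ) ≤ (((c * d : ℕ) : ℝ) * (a + 1)) ^ 4 := by
    have : #T ≤ (c * d * (a + 1)) ^ 4 := by
      refine (card_filter_le _ _).trans_eq ?_
      simp only [card_product, hR, card_range]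
      ring
    exact_mod_cast this
  calc (#(failSet N J c d t c₁ a) : ℝ)
      ≤ ∑ p ∈ T, (#(profileSet N J c d t c₁ a p.1 p.2.1 p.2.2.1 p.2.2.2) : ℝ) := by
        exact_mod_cast (card_le_card hsub).trans
          (card_biUnion_le.trans (sum_le_sum fun p _ => card_image_le))
    _ ≤ ∑ p ∈ T, Real.exp 5 * (((c * d : ℕ) : ℝ) * (a + 1)) ^ 3 * Real.exp (-β * a)
          * (N * c).factorial :=
        sum_le_sum fun p hp =>
          card_profileSet_le_exp hN h₁ hcc htd hJ (mem_filter.1 hp).2 hf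
    _ = #T * (Real.exp 5 * (((c * d : ℕ) : ℝ) * (a + 1)) ^ 3 * Real.exp (-β * a)
          * (N * c).factorial) := by rw [sum_const, nsmul_eq_mul]
    _ ≤ (((c * d : ℕ) : ℝ) * (a + 1)) ^ 4 * (Real.exp 5 * (((c * d : ℕ) : ℝ) * (a + 1)) ^ 3 *
          Real.exp (-β * a) * (N * c).factorial) := by gcongr
    _ = _ := by ring

end

noncomputable section

open Finset

variable {N J c d : ℕ}

/-! ### The decoder -/

section Decoder

variable {E : Ensemble N J c d} {C₀ : Submodule (ZMod 2) (Fin d → ZMod 2)} {t c₁ : ℕ}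
  {v x : Fin N → ZMod 2}

lemma hammingDist_checkWord (j : Fin J) :
    hammingDist (checkWord E v j) (checkWord E x j) = #(errorSockets E {i | v i ≠ x i} j) := by
  rw [hammingDist]
  congr 1
  ext m
  rw [errorSockets, mem_filter, mem_filter]
  refine and_congr_right fun _ => ?_
  rw [mem_filter]
  exact ⟨fun h => ⟨mem_univ _, h⟩, fun h => h.2⟩

/-- Two words of `C₀` within `t` of the word read are at distance at most `2 * t`, so the arbitrary
choice in `bdd` is forced. -/
lemma bdd_checkWord (hC : MinDistAtLeast C₀ (2 * t + 1)) (hx : x ∈ code E C₀) {j : Fin J}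
    (hj : j ∉ badChecks E t {i | v i ≠ x i}) :
    bdd C₀ t (checkWord E v j) = some (checkWord E x j) := by
  have hd : hammingDist (checkWord E v j) (checkWord E x j) ≤ t := by
    rw [hammingDist_checkWord]
    by_contra! h
    exact hj (mem_filter.2 ⟨mem_univ _, h⟩)
  have h : ∃ w ∈ C₀, hammingDist (checkWord E v j) w ≤ t := ⟨_, hx j, hd⟩
  rw [bdd, dif_pos h]
  congr 1
  by_contra hne
  have h1 := hC _ h.choose_spec.1 _ (hx j) hne
  have h2 := hammingDist_triangle_right h.choose (checkWord E x j) (checkWord E v j)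
  have h3 := h.choose_spec.2
  rw [hammingDist_comm] at h3 hd
  omega

lemma sendsFlip_iff (hC : MinDistAtLeast C₀ (2 * t + 1)) (hx : x ∈ code E C₀) {i : Fin N}
    {k : Fin c} (hj : (E (i, k)).1 ∉ badChecks E t {i | v i ≠ x i}) :
    SendsFlip E C₀ t v (E (i, k)).1 (E (i, k)).2 ↔ v i ≠ x i := by
  rw [SendsFlip, bdd_checkWord hC hx hj]
  simp [checkWord, eq_comm]

/-- Good checks vote correctly on every edge, so a node errs only through its bad sockets, whatever
the bad checks send: fewer than `c - c₁ + 1` of them leave `c₁` correct votes, and fewer than `c₁`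
cannot flip a correct node. -/
lemma ne_step_subset (hC : MinDistAtLeast C₀ (2 * t + 1)) (hx : x ∈ code E C₀) (hcc : c₁ ≤ c) :
    ({i | step E C₀ t c₁ v i ≠ x i} : Finset (Fin N)) ⊆
      stuckNodes E t c₁ {i | v i ≠ x i} ∪ spoiledNodes E t c₁ {i | v i ≠ x i} := by
  classical
  intro i hi
  have hi := (mem_filter.1 hi).2
  set A : Finset (Fin N) := {i | v i ≠ x i} with hA
  by_cases hiA : v i ≠ x i
  · refine mem_union_left _ (mem_filter.2 ⟨mem_univ _, mem_filter.2 ⟨mem_univ _, hiA⟩, ?_⟩)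
    by_contra! hlt
    have h1 : c₁ ≤ flipCount E C₀ t v i := by
      have h2 : #((badSockets E t A i)ᶜ) ≤ flipCount E C₀ t v i := by
        refine card_le_card fun k hk => mem_filter.2 ⟨mem_univ _, ?_⟩
        rw [mem_compl, badSockets, mem_filter] at hk
        exact (sendsFlip_iff hC hx fun h => hk ⟨mem_univ _, h⟩).2 hiA
      rw [card_compl, Fintype.card_fin] at h2
      omega
    rw [step, if_pos h1] at hi
    exact hi ((by decide : ∀ a b : ZMod 2, a ≠ b → a + 1 = b) _ _ hiA)
  · refine mem_union_right _ (mem_filter.2 ⟨mem_univ _, fun h => hiA (mem_filter.1 h).2, ?_⟩)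
    by_contra! hlt
    refine hi ?_
    have h1 : flipCount E C₀ t v i ≤ #(badSockets E t A i) := by
      refine card_le_card fun k hk => ?_
      by_contra hb
      rw [badSockets, mem_filter] at hb
      exact hiA ((sendsFlip_iff hC hx fun h => hb ⟨mem_univ _, h⟩).1 (mem_filter.1 hk).2)
    rw [step, if_neg (by omega)]
    exact not_not.1 hiA

lemma step_eq_self (hC : MinDistAtLeast C₀ (2 * t + 1)) (hx : x ∈ code E C₀) (h₁ : 1 ≤ c₁)
    (hcc : c₁ ≤ c) : step E C₀ t c₁ x = x := by
  have h := ne_step_subset (v := x) hC hx hcc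
  ext1 i
  by_contra hne
  have hi := h (mem_filter.2 ⟨mem_univ _, hne⟩)
  simp only [ne_eq, not_true_eq_false, filter_false, mem_union, stuckNodes, spoiledNodes,
    mem_filter, badSockets, badChecks, errorSockets] at hi
  simp at hi
  omega

/-- Strong induction on the number of errors, which strictly decreases and so never leaves the range
covered by `h`. -/
lemma correctsAll_of_notMem_failSet (hC : MinDistAtLeast C₀ (2 * t + 1)) (h₁ : 1 ≤ c₁)
    (hcc : c₁ ≤ c) {W : ℕ} (h : ∀ a, 1 ≤ a → a ≤ W → E ∉ failSet N J c d t c₁ a) :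
    CorrectsAll E C₀ t c₁ W := by
  intro x hx v
  induction hn : hammingDist v x using Nat.strong_induction_on generalizing v with
  | _ n ih =>
    intro hW
    rcases Nat.eq_zero_or_pos n with rfl | hpos
    · rw [hammingDist_eq_zero] at hn
      subst hn
      exact ⟨0, fun l _ => Function.iterate_fixed (step_eq_self hC hx h₁ hcc) l⟩
    · have hlt : hammingDist (step E C₀ t c₁ v) x < n := by
        by_contra! hge
        refine h n hpos hW (mem_filter.2 ⟨mem_univ _, ({i | v i ≠ x i} : Finset (Fin N)), hn, ?_⟩)
        refine hge.trans ?_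
        exact (card_le_card (ne_step_subset hC hx hcc)).trans (card_union_le _ _)
      obtain ⟨L, hL⟩ := ih _ hlt (step E C₀ t c₁ v) rfl (hlt.le.trans hW)
      refine ⟨L + 1, fun l hl => ?_⟩
      obtain ⟨m, rfl⟩ : ∃ m, l = m + 1 := ⟨l - 1, by omega⟩
      rw [Function.iterate_succ_apply]
      exact hL m (by omega)

end Decoder

/-! ### The fraction of good matchings -/

lemma card_ensemble (h : N * c = J * d) : Nat.card (Ensemble N J c d) = (N * c).factorial := by
  have e : Fin N × Fin c ≃ Fin J × Fin d := Fintype.equivOfCardEq (by simpa using h)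
  rw [Nat.card_eq_fintype_card, Fintype.card_equiv e]
  simp

lemma goodFraction_le_one (C₀ : Submodule (ZMod 2) (Fin d → ZMod 2)) (t c₁ W : ℕ) :
    goodFraction N c C₀ t c₁ W ≤ 1 := by
  refine div_le_one_of_le₀ ?_ (by positivity)
  exact_mod_cast Nat.card_le_card_of_injective _ Subtype.val_injective

lemma one_sub_le_goodFraction {C₀ : Submodule (ZMod 2) (Fin d → ZMod 2)} {t c₁ W : ℕ}
    (hC : MinDistAtLeast C₀ (2 * t + 1)) (h₁ : 1 ≤ c₁) (hcc : c₁ ≤ c) (hdvd : d ∣ N * c) :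
    1 - ∑ a ∈ Icc 1 W, (#(failSet N (N * c / d) c d t c₁ a) : ℝ) / (N * c).factorial ≤
      goodFraction N c C₀ t c₁ W := by
  classical
  have hJ : N * c = N * c / d * d := (Nat.div_mul_cancel hdvd).symm
  have hfac : (0 : ℝ) < (N * c).factorial := by exact_mod_cast Nat.factorial_pos _
  rw [goodFraction, card_ensemble hJ, ← sum_div, le_div_iff₀ hfac, sub_mul, one_mul,
    div_mul_cancel₀ _ hfac.ne', sub_le_iff_le_add]
  have h1 : (N * c).factorial ≤ Nat.card {E : Ensemble N (N * c / d) c d //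
      CorrectsAll E C₀ t c₁ W} + ∑ a ∈ Icc 1 W, #(failSet N (N * c / d) c d t c₁ a) := by
    rw [← card_ensemble hJ, Nat.card_eq_fintype_card, Nat.card_eq_fintype_card,
      Fintype.card_subtype, ← card_univ]
    refine le_trans (card_le_card (t := ({E | CorrectsAll E C₀ t c₁ W} : Finset _) ∪
      (Icc 1 W).biUnion fun a => failSet N (N * c / d) c d t c₁ a) ?_)
      ((card_union_le _ _).trans (Nat.add_le_add_left card_biUnion_le _))
    intro E _
    rw [mem_union, mem_filter, mem_biUnion]
    by_contra hcon
    rw [not_or] at hcon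
    refine hcon.1 ⟨mem_univ _, correctsAll_of_notMem_failSet hC h₁ hcc fun a ha haW hE => ?_⟩
    exact hcon.2 ⟨a, mem_Icc.2 ⟨ha, haW⟩, hE⟩
  exact_mod_cast h1

lemma summable_poly_mul_exp {η : ℝ} (hη : 0 < η) (K : ℝ) :
    Summable fun a : ℕ => Real.exp 5 * (K * ((a : ℝ) + 1)) ^ 7 * Real.exp (-η * a) := by
  have h := (summable_nat_add_iff 1).2 (Real.summable_pow_mul_exp_neg_nat_mul 7 hη)
  refine (h.mul_left (Real.exp 5 * K ^ 7 * Real.exp η)).congr fun a => ?_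
  have : Real.exp (-η * a) = Real.exp η * Real.exp (-η * ((a + 1 : ℕ) : ℝ)) := by
    rw [← Real.exp_add]
    congr 1
    push_cast
    ring
  rw [this, mul_pow]
  push_cast
  ring

lemma tendsto_goodFraction {t c₁ : ℕ} (ht : 0 < t) (htd : t < d) (hT : ThresholdCondition c t c₁)
    {C₀ : Submodule (ZMod 2) (Fin d → ZMod 2)} (hC : MinDistAtLeast C₀ (2 * t + 1)) {α' : ℝ}
    (hneg : ∀ α, 0 < α → α ≤ α' → ∀ γ δ φ ω, Feasible c d t c₁ α γ δ φ ω →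
      psi c d t c₁ α γ δ φ ω < 0) :
    Tendsto (fun N : ℕ => goodFraction N c C₀ t c₁ ⌊α' * N⌋₊)
      (atTop ⊓ 𝓟 {N : ℕ | d ∣ N * c}) (𝓝 1) := by
  have h₁ : 1 ≤ c₁ := by linarith [hT.1]
  have hcc := hT.lt.le
  obtain ⟨η, hη, hf⟩ := exists_forall_f_le_mul hT ht (by omega : 0 < d) hneg
  set bound : ℕ → ℝ := fun a =>
    Real.exp 5 * (((c * d : ℕ) : ℝ) * ((a : ℝ) + 1)) ^ 7 * Real.exp (-η * a)
  set T : ℕ → ℕ → ℝ := fun N a => if a ∈ Icc 1 ⌊α' * N⌋₊ then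
    (#(failSet N (N * c / d) c d t c₁ a) : ℝ) / (N * c).factorial else 0 with hTdef
  have hT0 : ∀ N a, 0 ≤ T N a := fun N a => by
    simp only [hTdef]
    split_ifs <;> positivity
  have hgood : ∀ᶠ N in atTop ⊓ 𝓟 {N : ℕ | d ∣ N * c}, 0 < N ∧ d ∣ N * c := by
    rw [eventually_inf_principal]
    filter_upwards [eventually_gt_atTop 0] with N hN hdvd using ⟨hN, hdvd⟩
  -- The slope `β` is left free: `η` gives the summable dominating sequence, and arbitrarily large
  -- slopes give convergence of each term to `0`.
  have hTle : ∀ N a, 0 < N → d ∣ N * c → ∀ β, 0 ≤ β →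
      (a ∈ Icc 1 ⌊α' * N⌋₊ → f c d t c₁ (a / N) ≤ ((-β * (a / N) : ℝ) : EReal)) →
      T N a ≤ Real.exp 5 * (((c * d : ℕ) : ℝ) * ((a : ℝ) + 1)) ^ 7 * Real.exp (-β * a) := by
    intro N a hN hdvd β hβ hfa
    simp only [hTdef]
    split_ifs with ha
    · rw [div_le_iff₀ (by exact_mod_cast Nat.factorial_pos _)]
      exact card_failSet_le hN h₁ hcc htd (Nat.div_mul_cancel hdvd).symm (hfa ha)
    · positivity
  have hbound : ∀ᶠ N in atTop ⊓ 𝓟 {N : ℕ | d ∣ N * c}, ∀ a, ‖T N a‖ ≤ bound a := by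
    filter_upwards [hgood] with N hN a
    rw [Real.norm_of_nonneg (hT0 N a)]
    refine hTle N a hN.1 hN.2 η hη.le fun ha => ?_
    have hN' : (0 : ℝ) < N := by exact_mod_cast hN.1
    obtain ⟨ha1, ha2⟩ := mem_Icc.1 ha
    have ha0 : (0 : ℝ) < a := by exact_mod_cast ha1
    refine hf _ (by positivity) ?_
    rw [div_le_iff₀ hN']
    -- This form of the floor inequality needs `a ≠ 0` and no sign of `α'`.
    exact (Nat.le_floor_iff' (by omega)).1 ha2
  have hterm : ∀ a, Tendsto (fun N => T N a) (atTop ⊓ 𝓟 {N : ℕ | d ∣ N * c}) (𝓝 0) := by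
    intro a
    rcases Nat.eq_zero_or_pos a with rfl | ha
    · simp [hTdef, tendsto_const_nhds]
    have ha' : (0 : ℝ) < a := by exact_mod_cast ha
    set C := Real.exp 5 * (((c * d : ℕ) : ℝ) * ((a : ℝ) + 1)) ^ 7
    have hlim : Tendsto (fun M : ℝ => C * Real.exp (-M * a)) atTop (𝓝 0) := by
      have h1 : Tendsto (fun M : ℝ => -M * a) atTop atBot :=
        (tendsto_neg_atTop_atBot).atBot_mul_const ha'
      simpa using (Real.tendsto_exp_atBot.comp h1).const_mul C
    refine tendsto_order.2 ⟨fun r hr => Eventually.of_forall fun N => hr.trans_le (hT0 N a),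
      fun r hr => ?_⟩
    -- For fixed `a`, first choose the slope `M` that makes the bound smaller than `r`; then `a / N`
    -- eventually enters the interval where `f` lies below that line.
    obtain ⟨M, hMr, hM0⟩ := ((hlim.eventually (gt_mem_nhds hr)).and (eventually_ge_atTop 0)).exists
    obtain ⟨ε, hε, hfε⟩ := exists_forall_f_le_neg_mul (d := d) hT ht (by omega) M
    have hsmall : ∀ᶠ N : ℕ in atTop ⊓ 𝓟 {N : ℕ | d ∣ N * c}, (a : ℝ) / N < ε :=
      ((tendsto_const_div_atTop_nhds_zero_nat (a : ℝ)).eventually (gt_mem_nhds hε)).filter_mono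
        inf_le_left
    filter_upwards [hgood, hsmall] with N hN hNε
    have hN' : (0 : ℝ) < N := by exact_mod_cast hN.1
    exact (hTle N a hN.1 hN.2 M hM0 fun _ => hfε _ (by positivity) hNε).trans_lt hMr
  have hsum := tendsto_tsum_of_dominated_convergence (summable_poly_mul_exp hη ((c * d : ℕ) : ℝ))
    hterm hbound
  rw [tsum_zero] at hsum
  have hlow : Tendsto (fun N => 1 - ∑' a, T N a) (atTop ⊓ 𝓟 {N : ℕ | d ∣ N * c}) (𝓝 1) := by
    simpa using hsum.const_sub 1
  refine tendsto_of_tendsto_of_tendsto_of_le_of_le' hlow tendsto_const_nhds ?_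
    (Eventually.of_forall fun N => goodFraction_le_one C₀ t c₁ _)
  filter_upwards [hgood] with N hN
  refine le_trans (le_of_eq ?_) (one_sub_le_goodFraction hC h₁ hcc hN.2)
  congr 1
  rw [tsum_eq_sum (s := Icc 1 ⌊α' * N⌋₊) fun a ha => if_neg ha]
  exact sum_congr rfl fun a ha => if_pos ha

/-! ### The majority threshold -/

lemma thresholdCondition_half {c t : ℕ} (h : (4 ≤ c ∧ 1 ≤ t) ∨ (c = 3 ∧ 2 ≤ t)) :
    ThresholdCondition c t ⌈(c : ℝ) / 2⌉₊ := by
  have hceil : ⌈(c : ℝ) / 2⌉₊ = (c + 1) / 2 := by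
    rw [Nat.ceil_eq_iff (by omega)]
    constructor
    · rw [lt_div_iff₀ two_pos]
      have : ((c + 1) / 2 - 1) * 2 < c := by omega
      exact_mod_cast this
    · rw [div_le_iff₀ two_pos]
      have : c ≤ (c + 1) / 2 * 2 := by omega
      exact_mod_cast this
  rw [hceil]
  refine ⟨by omega, ?_⟩
  have ht : (0 : ℝ) < (t : ℝ) + 1 := by positivity
  rw [gt_iff_lt, ← mul_div_assoc, lt_div_iff₀ ht, one_mul]
  rcases h with ⟨hc, ht1⟩ | ⟨rfl, ht2⟩
  -- Here `c - c₁ + 1 ≥ 3`, and `3 t > t + 1` for `t ≥ 1`. For `c = 3` the factor is only `2`, which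
  -- requires `t ≥ 2`.
  · have h1 : (((c + 1) / 2 : ℕ) : ℝ) + 2 ≤ c := by exact_mod_cast (by omega : (c + 1) / 2 + 2 ≤ c)
    have h2 : (1 : ℝ) ≤ t := by exact_mod_cast ht1
    nlinarith
  · have h2 : (2 : ℝ) ≤ t := by exact_mod_cast ht2
    norm_num
    linarith

end

end GLDPC

theorem theorem1 :
    (∀ c d t c₁ : ℕ, 0 < t → 2 * t + 1 ≤ d → GLDPC.ThresholdCondition c t c₁ →
      ∃ α₀ : ℝ, IsLeast {α : ℝ | 0 < α ∧ GLDPC.f c d t c₁ α = 0} α₀ ∧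
        ∀ C₀ : Submodule (ZMod 2) (Fin d → ZMod 2), GLDPC.MinDistAtLeast C₀ (2 * t + 1) →
          ∀ α' : ℝ, α' < α₀ →
            Tendsto (fun N : ℕ => GLDPC.goodFraction N c C₀ t c₁ ⌊α' * N⌋₊)
              (atTop ⊓ 𝓟 {N : ℕ | d ∣ N * c}) (𝓝 1)) ∧
    (∀ c t : ℕ, (4 ≤ c ∧ 1 ≤ t) ∨ (c = 3 ∧ 2 ≤ t) →
      GLDPC.ThresholdCondition c t ⌈(c : ℝ) / 2⌉₊) := by
  refine ⟨fun c d t c₁ ht hd hT => ?_, fun c t h => GLDPC.thresholdCondition_half h⟩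
  obtain ⟨α₀, hα₀, hneg⟩ := GLDPC.exists_isLeast_root (d := d) hT ht (by omega)
  exact ⟨α₀, hα₀, fun C₀ hC α' hα' => GLDPC.tendsto_goodFraction ht (by omega) hT hC
    fun α h0 h1 => hneg α h0 (h1.trans_lt hα')⟩
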